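/- For $p>0$ and a sequence of real numbers $\tau=(\tau_n)_{n\ge 0}$ with $0=\tau_0<\tau_1<\tau_2<\cdots$ define \[K_p(\tau;x)=\sum_{n=0}^{\infty}\chi_{(\tau_n,\tau_{n+1})}(x)\,\frac{\sin\left(\frac p2\pi(x-n)\right)}{\pi x},\qquad E_p(\tau)=\int_0^\infty\bigl(\max(0,K_p(\tau;x))\bigr)^2\,dx,\] where $\chi_{(a,b)}$ is the characteristic function of the interval $(a,b)$. For $\delta_1,\delta_2>0$ let \[T(\delta_1,\delta_2)=\{\tau=(\tau_n)_{n\ge0}:\ \tau_0=0,\ \tau_1\ge\delta_1,\ \tau_{n+1}-\tau_n\ge\delta_2\text{ for all }n\ge1\},\qquad \mathscr E_p(\delta_1,\delta_2)=\sup_{\tau\in T(\delta_1,\delta_2)}E_p(\tau).\] Theorem 1.2. Fix $2\le p\le 4$ and let $\min(2/\pi,2/p)\le\delta_1\le 1$ and $2/3\le\delta_2\le 1$. Then \[\mathscr E_p(\delta_1,\delta_2)=\sum_{n=0}^\infty\int_n^{n+2/p}\frac{\sin^2\left(\frac p2\pi(x-n)\right)}{\pi^2x^2}\,dx,\] where all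 the integrals converge, and the series and the supremum are finite. If $2\le p<4$, then a sequence $\tau\in T(\delta_1,\delta_2)$ attains the supremum, that is, $E_p(\tau)=\mathscr E_p(\delta_1,\delta_2)$, if and only if $\tau_n\in[n-1+2/p,\,n]$ for all $n\ge1$. If $p=4$, then every sequence $\tau\in T(\delta_1,\delta_2)$ attains the supremum. -/

import Mathlib

noncomputable section

/-- The kernel `K_p(τ; x) = ∑_{n ≥ 0} χ_{(τ_n, τ_{n+1})}(x) sin((p/2) π (x - n)) / (π x)`.
For a monotone `τ` at most one term of the series is nonzero at each `x`. -/
def kernelK (p : ℝ) (τ : ℕ → ℝ) (x : ℝ) : ℝ :=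
  ∑' n : ℕ, Set.indicator (Set.Ioo (τ n) (τ (n + 1)))
    (fun y : ℝ => Real.sin (p / 2 * Real.pi * (y - n)) / (Real.pi * y)) x

/-- The functional `E_p(τ) = ∫_0^∞ (max (0, K_p(τ; x)))^2 dx`. -/
def functionalE (p : ℝ) (τ : ℕ → ℝ) : ℝ :=
  ∫ x in Set.Ioi (0 : ℝ), (max 0 (kernelK p τ x)) ^ 2

/-- The set `T(δ₁, δ₂)` of separated sequences: `τ_0 = 0`, `τ_1 ≥ δ₁` and
`τ_{n+1} - τ_n ≥ δ₂` for all `n ≥ 1`. -/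
def separatedSeq (δ₁ δ₂ : ℝ) : Set (ℕ → ℝ) :=
  {τ | τ 0 = 0 ∧ δ₁ ≤ τ 1 ∧ ∀ n : ℕ, 1 ≤ n → δ₂ ≤ τ (n + 1) - τ n}

/-- The value `𝓔_p(δ₁, δ₂) = sup {E_p(τ) : τ ∈ T(δ₁, δ₂)}` of the optimization problem. -/
def supE (p δ₁ δ₂ : ℝ) : ℝ :=
  sSup (functionalE p '' separatedSeq δ₁ δ₂)

end

/-!
# The extremal problem for `E_p` on separated sequences, `2 ≤ p ≤ 4`

Put `a = 2/p ∈ [1/2, 1]`, `S(y) = max(0, sin(π y / a))²` and `D(y) = S(y) - S(y + 1)`. On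
`(τ_n, τ_{n+1})` the integrand of `E_p` is `S(x - n) / (π² x²)`, so summation by parts over the
breakpoints gives `E_p(ℕ) - E_p(τ) = ∑_{n ≥ 1} H_n(τ_n)` with
`π² H_n(t) = ∫_n^t D(x - n) x⁻² dx`: the breakpoints contribute independently
(`tendsto_sum_breakpointLoss`). The sum of the theorem is `E_p(ℕ)`, and what has to be shown is
`∑ H_n(τ_n) ≥ 0`, with the cases of equality.

Let `P(u) = ∫₀ᵘ D` and `u_n = τ_n - n`. Integration by parts (`breakpointLoss_eq`) gives
`π² H_n = P(u_n) / τ_n² + ∫₀^{u_n} 2 P(y) / (n + y)³ dy`. The function `P` is nonnegative, has period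
`2a`, and on a period it is one symmetric unimodal hump, supported for instance on `[-2a, a - 1]`
and zero on `[a - 1, 0]`. Hence `H_n ≥ 0` for `τ_n ≥ n`, but a single `H_n` may be negative when
`τ_n` lies far below `n`. There the separation of `τ` enters: `u_{n+1} ≥ u_n - 1/3`, so the sequence
`u` cannot descend without visiting every hump, where it collects the positive terms
`P(u_n) / τ_n²`, the *budgets*.

The negative terms, the *costs*, are summed first over all `n` with `u_n < y`, for each `y` (replacing
`∑_{k ≥ 0} 2 / (x + k)³` by the explicit `tailWeight x`), which turns them into a price for each step
of the running minimum of `u` (`sum_cost_le_descent`). The steps are then paid for by an amortized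
argument with a credit (`credit_step`): on a monotone side of a hump the price of a step is compared
with the budget at its end nearer to the centre, and a step across the centre of a hump is paid for
jointly by the budgets at its two ends (`straddle_le`). The latter is the only place that uses the
shape of the hump, in the form `P ≥ P_max cos²(π z / a)` at distance `z ≤ a/2` from the centre
(`cos_sq_le_bump`). All of this costs at most `0.99` of the budgets, and the remaining hundredth
forces `P(u_n) = 0` in the case of equality. Since `P > 0` on `(-2a, a - 1)`, an interval longer
than `1/3`, this confines every `u_n` to `[a - 1, 0]` when `p < 4`; for `p = 4` the function `D`
vanishes identically.
-/

open Real Set MeasureTheory Filter Topology intervalIntegral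

/-! ### The squared positive part of the sine and its running difference -/

/-- The function `S(y) = max(0, sin(π y / a))²`; it has period `2a`, and with `a = 2/p` the squared
positive part of the kernel on `(τ_n, τ_{n+1})` is `S(x - n) / (π² x²)`. -/
noncomputable def sineHump (a y : ℝ) : ℝ := (max 0 (sin (π * y / a))) ^ 2

/-- `D(y) = S(y) - S(y + 1)`: the (unweighted) change of the integrand at `x = n + y` when the
breakpoint `τ_n` is moved past `x`. -/
noncomputable def humpDiff (a y : ℝ) : ℝ := sineHump a y - sineHump a (y + 1)

/-- `P(u) = ∫₀ᵘ D`. -/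
noncomputable def humpPrim (a u : ℝ) : ℝ := ∫ t in (0 : ℝ)..u, humpDiff a t

/-- The primitive `P` recentred at the centre `-(a+1)/2` of one of its humps. -/
noncomputable def bump (a z : ℝ) : ℝ := humpPrim a (z - (a + 1) / 2)

theorem sineHump_nonneg (a y : ℝ) : 0 ≤ sineHump a y := sq_nonneg _

theorem sineHump_le_one (a y : ℝ) : sineHump a y ≤ 1 := by
  have h0 : 0 ≤ max 0 (sin (π * y / a)) := le_max_left _ _
  have h1 : max 0 (sin (π * y / a)) ≤ 1 := max_le zero_le_one (sin_le_one _)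
  exact pow_le_one₀ h0 h1

theorem continuous_sineHump (a : ℝ) : Continuous (sineHump a) := by
  unfold sineHump; fun_prop

theorem continuous_humpDiff (a : ℝ) : Continuous (humpDiff a) :=
  (continuous_sineHump a).sub ((continuous_sineHump a).comp (by fun_prop))

section hump
variable {a : ℝ}

theorem sineHump_add_period (ha : 0 < a) (y : ℝ) : sineHump a (y + 2 * a) = sineHump a y := by
  unfold sineHump
  rw [show π * (y + 2 * a) / a = π * y / a + 2 * π by field_simp, sin_add_two_pi]

theorem sineHump_reflect (ha : 0 < a) (y : ℝ) : sineHump a (a - y) = sineHump a y := by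
  unfold sineHump
  rw [show π * (a - y) / a = π - π * y / a by field_simp, sin_pi_sub]

theorem sineHump_of_mem (ha : 0 < a) {y : ℝ} (h0 : 0 ≤ y) (h1 : y ≤ a) :
    sineHump a y = sin (π * y / a) ^ 2 := by
  unfold sineHump
  rw [max_eq_right]
  apply sin_nonneg_of_nonneg_of_le_pi (by positivity)
  rw [div_le_iff₀ ha]
  gcongr

theorem sineHump_eq_zero (ha : 0 < a) {y : ℝ} (h0 : a ≤ y) (h1 : y ≤ 2 * a) :
    sineHump a y = 0 := by
  unfold sineHump
  have h2 : sin (π * y / a) ≤ 0 := by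
    have h3 : 0 ≤ sin (2 * π - π * y / a) := by
      apply sin_nonneg_of_nonneg_of_le_pi
      · rw [sub_nonneg, div_le_iff₀ ha]; nlinarith [pi_pos]
      · rw [sub_le_comm, le_div_iff₀ ha]; nlinarith [pi_pos]
    rw [sin_two_pi_sub] at h3
    linarith
  rw [max_eq_left h2]; simp

theorem hasDerivAt_humpPrim (a u : ℝ) : HasDerivAt (humpPrim a) (humpDiff a u) u :=
  integral_hasDerivAt_right ((continuous_humpDiff a).intervalIntegrable _ _)
    ((continuous_humpDiff a).stronglyMeasurableAtFilter _ _) (continuous_humpDiff a).continuousAt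

@[simp] theorem humpPrim_zero (a : ℝ) : humpPrim a 0 = 0 := by simp [humpPrim]

theorem continuous_humpPrim (a : ℝ) : Continuous (humpPrim a) :=
  continuous_iff_continuousAt.2 fun u => (hasDerivAt_humpPrim a u).continuousAt

theorem hasDerivAt_bump (a z : ℝ) : HasDerivAt (bump a) (humpDiff a (z - (a + 1) / 2)) z := by
  have := (hasDerivAt_humpPrim a (z - (a + 1) / 2)).comp_sub_const z ((a + 1) / 2)
  exact this

theorem continuous_bump (a : ℝ) : Continuous (bump a) :=
  (continuous_humpPrim a).comp (by fun_prop)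

theorem humpDiff_recentred (ha : 0 < a) (z : ℝ) :
    humpDiff a (z - (a + 1) / 2) = sineHump a ((1 - a) / 2 - z) - sineHump a ((1 - a) / 2 + z) := by
  unfold humpDiff
  congr 1
  · rw [← sineHump_reflect ha, ← sineHump_add_period ha ((1 - a) / 2 - z)]
    congr 1; ring
  · congr 1; ring

theorem bump_neg (ha : 0 < a) (z : ℝ) : bump a (-z) = bump a z := by
  have hd : ∀ x, HasDerivAt (fun z => bump a (-z) - bump a z) 0 x := by
    intro x
    have h1 := (hasDerivAt_bump a (-x)).comp x (hasDerivAt_neg x)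
    have h2 := h1.sub (hasDerivAt_bump a x)
    refine h2.congr_deriv ?_
    rw [humpDiff_recentred ha, humpDiff_recentred ha]
    simp only [sub_neg_eq_add, ← sub_eq_add_neg]
    ring
  have := is_const_of_deriv_eq_zero (fun x => (hd x).differentiableAt) (fun x => (hd x).deriv) z 0
  simp at this
  linarith

theorem bump_add_period (ha : 0 < a) (z : ℝ) : bump a (z + 2 * a) = bump a z := by
  have hd : ∀ x, HasDerivAt (fun z => bump a (z + 2 * a) - bump a z) 0 x := by
    intro x
    have h1 := (hasDerivAt_bump a (x + 2 * a)).comp_add_const x (2 * a)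
    have h2 := h1.sub (hasDerivAt_bump a x)
    refine h2.congr_deriv ?_
    rw [humpDiff_recentred ha, humpDiff_recentred ha, ← sineHump_add_period ha (_ + x),
      ← sineHump_add_period ha (_ - (x + 2 * a))]
    ring_nf
  have := is_const_of_deriv_eq_zero (fun x => (hd x).differentiableAt) (fun x => (hd x).deriv) z (-a)
  have h3 := bump_neg ha a
  simp only [show -a + 2 * a = a by ring, h3] at this
  linarith

theorem bump_sub_period (ha : 0 < a) (z : ℝ) : bump a (z - 2 * a) = bump a z := by
  rw [← bump_add_period ha, sub_add_cancel]

theorem bump_abs (ha : 0 < a) (z : ℝ) : bump a |z| = bump a z := by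
  rcases abs_choice z with h | h <;> rw [h]
  exact bump_neg ha z

theorem humpPrim_eq_bump (a u : ℝ) : humpPrim a u = bump a (u + (a + 1) / 2) := by
  simp [bump]

/-- A hump has half-width `(3a - 1)/2`; between two humps `P` vanishes. -/
theorem bump_eq_of_edge (ha : 1 / 2 ≤ a) (ha1 : a ≤ 1) {z : ℝ} (h0 : (3 * a - 1) / 2 ≤ z)
    (h1 : z ≤ a) : bump a z = 0 := by
  have hpos : 0 < a := by linarith
  have key : ∀ w ∈ Icc ((3 * a - 1) / 2) ((a + 1) / 2), bump a w = bump a ((a + 1) / 2) := by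
    intro w hw
    have := integral_eq_sub_of_hasDerivAt (a := w) (b := (a + 1) / 2)
      (fun x _ => hasDerivAt_bump a x)
      (((continuous_humpDiff a).comp (by fun_prop : Continuous fun x => x - (a + 1) / 2)).intervalIntegrable _ _)
    rw [integral_congr (g := fun _ => 0)] at this
    · simp at this; linarith
    · intro x hx
      rw [uIcc_of_le hw.2] at hx
      have hx1 : (3 * a - 1) / 2 ≤ x := hw.1.trans hx.1
      simp only
      rw [humpDiff_recentred hpos, ← sineHump_add_period hpos (_ - x),
        sineHump_eq_zero hpos, sineHump_eq_zero hpos, sub_zero] <;>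
      linarith [hx.2]
  rw [key z ⟨h0, by linarith⟩]
  simp [bump]

/-- Each half of a hump is monotone. -/
theorem bump_antitoneOn (ha : 1 / 2 ≤ a) (ha1 : a ≤ 1) : AntitoneOn (bump a) (Icc 0 a) := by
  have hpos : 0 < a := by linarith
  apply antitoneOn_of_deriv_nonpos (convex_Icc _ _) (continuous_bump a).continuousOn
    (fun x _ => (hasDerivAt_bump a x).differentiableAt.differentiableWithinAt)
  intro x hx
  rw [interior_Icc] at hx
  rw [(hasDerivAt_bump a x).deriv, humpDiff_recentred hpos, sub_nonpos]
  obtain ⟨h0, h1⟩ := hx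
  rcases le_total x ((1 - a) / 2) with h | h
  · rw [sineHump_of_mem hpos (by linarith) (by linarith),
      sineHump_of_mem hpos (by linarith) (by linarith)]
    have hA : 0 ≤ sin (π * ((1 - a) / 2 - x) / a) := by
      apply sin_nonneg_of_nonneg_of_le_pi
      · have : 0 ≤ (1 - a) / 2 - x := by linarith
        positivity
      · rw [div_le_iff₀ hpos]; gcongr; linarith
    apply pow_le_pow_left₀ hA
    rw [← sub_nonneg, sin_sub_sin]
    rw [show (π * ((1 - a) / 2 + x) / a - π * ((1 - a) / 2 - x) / a) / 2 = π * x / a by ring,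
      show (π * ((1 - a) / 2 + x) / a + π * ((1 - a) / 2 - x) / a) / 2 = π * ((1 - a) / 2) / a by ring]
    have h2 : 0 ≤ sin (π * x / a) := by
      apply sin_nonneg_of_nonneg_of_le_pi (by positivity)
      rw [div_le_iff₀ hpos]; gcongr
    have h3 : 0 ≤ cos (π * ((1 - a) / 2) / a) := by
      apply cos_nonneg_of_neg_pi_div_two_le_of_le
      · have : 0 ≤ π * ((1 - a) / 2) / a := by
          have : 0 ≤ (1 - a) / 2 := by linarith
          positivity
        linarith [pi_pos]
      · rw [div_le_iff₀ hpos]; nlinarith [pi_pos]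
    positivity
  · rw [← sineHump_add_period hpos, sineHump_eq_zero hpos (by linarith) (by linarith)]
    exact sineHump_nonneg _ _

/-- Every real number lies, up to the period, in `[-a, a)`. -/
theorem exists_reduced (ha : 0 < a) (z : ℝ) :
    ∃ w, -a ≤ w ∧ w < a ∧ bump a z = bump a w := by
  have hp : Function.Periodic (bump a) (2 * a) := bump_add_period ha
  have h2 : 0 < 2 * a := by linarith
  obtain ⟨w, hw, h⟩ := hp.exists_mem_Ico h2 z (-a)
  exact ⟨w, hw.1, by linarith [hw.2], h⟩

theorem bump_nonneg (ha : 1 / 2 ≤ a) (ha1 : a ≤ 1) (z : ℝ) : 0 ≤ bump a z := by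
  obtain ⟨w, h0, h1, h⟩ := exists_reduced (by linarith : 0 < a) z
  rw [h, ← bump_abs (by linarith), ← bump_eq_of_edge ha ha1 (by linarith : (3 * a - 1) / 2 ≤ a) le_rfl]
  have : |w| ≤ a := abs_le.2 ⟨h0, h1.le⟩
  exact bump_antitoneOn ha ha1 ⟨abs_nonneg _, this⟩ ⟨by linarith, le_rfl⟩ this

theorem bump_le_center (ha : 1 / 2 ≤ a) (ha1 : a ≤ 1) (z : ℝ) : bump a z ≤ bump a 0 := by
  obtain ⟨w, h0, h1, h⟩ := exists_reduced (by linarith : 0 < a) z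
  rw [h, ← bump_abs (by linarith)]
  exact bump_antitoneOn ha ha1 ⟨le_rfl, by linarith⟩ ⟨abs_nonneg _, abs_le.2 ⟨h0, h1.le⟩⟩ (abs_nonneg _)

/-- The outer part of a hump in closed form. -/
theorem bump_outer (ha : 1 / 2 ≤ a) (ha1 : a ≤ 1) {z : ℝ} (h0 : (1 - a) / 2 ≤ z)
    (h1 : z ≤ (3 * a - 1) / 2) :
    bump a z = (a - (1 - a) / 2 - z) / 2 + a / (4 * π) * sin (2 * π * ((1 - a) / 2 + z) / a) := by
  have hpos : 0 < a := by linarith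
  have hder : ∀ x ∈ uIcc z ((3 * a - 1) / 2),
      HasDerivAt (fun z => (a - (1 - a) / 2 - z) / 2 + a / (4 * π) * sin (2 * π * ((1 - a) / 2 + z) / a))
        (humpDiff a (x - (a + 1) / 2)) x := by
    intro x hx
    rw [uIcc_of_le h1] at hx
    have e1 : HasDerivAt (fun z : ℝ => 2 * π * ((1 - a) / 2 + z) / a) (2 * π / a) x := by
      have := (((hasDerivAt_id x).const_add ((1 - a) / 2)).const_mul (2 * π)).div_const a
      simpa using this
    have e2 := (e1.sin.const_mul (a / (4 * π)))
    have e3 := (((hasDerivAt_id x).const_sub (a - (1 - a) / 2)).div_const 2).add e2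
    refine e3.congr_deriv ?_
    rw [humpDiff_recentred hpos, ← sineHump_add_period hpos (_ - x),
      sineHump_eq_zero hpos (by linarith [hx.2]) (by linarith [hx.1]),
      sineHump_of_mem hpos (by linarith [hx.1]) (by linarith [hx.2]), sin_sq_eq_half_sub]
    rw [show 2 * (π * ((1 - a) / 2 + x) / a) = 2 * π * ((1 - a) / 2 + x) / a by ring]
    field_simp
    ring
  have := integral_eq_sub_of_hasDerivAt hder
      (((continuous_humpDiff a).comp (by fun_prop : Continuous fun x => x - (a + 1) / 2)).intervalIntegrable _ _)
  have h3 := integral_eq_sub_of_hasDerivAt (a := z) (b := (3 * a - 1) / 2)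
      (fun x _ => hasDerivAt_bump a x)
      (((continuous_humpDiff a).comp (by fun_prop : Continuous fun x => x - (a + 1) / 2)).intervalIntegrable _ _)
  rw [h3] at this
  rw [bump_eq_of_edge ha ha1 le_rfl (by linarith)] at this
  rw [show 2 * π * ((1 - a) / 2 + (3 * a - 1) / 2) / a = 2 * π by field_simp; ring, sin_two_pi] at this
  linarith

/-- The inner part of a hump in closed form. -/
theorem bump_inner (ha : 1 / 2 ≤ a) (ha1 : a ≤ 1) {z : ℝ} (h0 : 0 ≤ z) (h1 : z ≤ (1 - a) / 2) :
    bump a z = (2 * a - 1) / 2 + a / (4 * π) * sin (2 * π * ((1 - a) / 2 + z) / a)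
      + a / (4 * π) * sin (2 * π * ((1 - a) / 2 - z) / a) := by
  have hpos : 0 < a := by linarith
  have hder : ∀ x ∈ uIcc z ((1 - a) / 2),
      HasDerivAt (fun z => (2 * a - 1) / 2 + a / (4 * π) * sin (2 * π * ((1 - a) / 2 + z) / a)
        + a / (4 * π) * sin (2 * π * ((1 - a) / 2 - z) / a))
        (humpDiff a (x - (a + 1) / 2)) x := by
    intro x hx
    rw [uIcc_of_le h1] at hx
    have e1 : HasDerivAt (fun z : ℝ => 2 * π * ((1 - a) / 2 + z) / a) (2 * π / a) x := by
      have := (((hasDerivAt_id x).const_add ((1 - a) / 2)).const_mul (2 * π)).div_const a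
      simpa using this
    have e1' : HasDerivAt (fun z : ℝ => 2 * π * ((1 - a) / 2 - z) / a) (-(2 * π / a)) x := by
      have := (((hasDerivAt_id x).const_sub ((1 - a) / 2)).const_mul (2 * π)).div_const a
      simpa [neg_div] using this
    have e3 := ((e1.sin.const_mul (a / (4 * π))).const_add ((2 * a - 1) / 2)).add
      (e1'.sin.const_mul (a / (4 * π)))
    refine e3.congr_deriv ?_
    rw [humpDiff_recentred hpos, sineHump_of_mem hpos (by linarith [hx.2]) (by linarith [hx.1]),
      sineHump_of_mem hpos (by linarith [hx.1]) (by linarith [hx.2]), sin_sq_eq_half_sub,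
      sin_sq_eq_half_sub]
    rw [show 2 * (π * ((1 - a) / 2 + x) / a) = 2 * π * ((1 - a) / 2 + x) / a by ring,
      show 2 * (π * ((1 - a) / 2 - x) / a) = 2 * π * ((1 - a) / 2 - x) / a by ring]
    field_simp
    ring
  have := integral_eq_sub_of_hasDerivAt hder
      (((continuous_humpDiff a).comp (by fun_prop : Continuous fun x => x - (a + 1) / 2)).intervalIntegrable _ _)
  have h3 := integral_eq_sub_of_hasDerivAt (a := z) (b := (1 - a) / 2)
      (fun x _ => hasDerivAt_bump a x)
      (((continuous_humpDiff a).comp (by fun_prop : Continuous fun x => x - (a + 1) / 2)).intervalIntegrable _ _)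
  rw [h3] at this
  rw [bump_outer ha ha1 le_rfl (by linarith), sub_self ((1 - a) / 2)] at this
  simp only [mul_zero, zero_div, sin_zero] at this
  linarith

theorem bump_pos (ha : 1 / 2 < a) (ha1 : a ≤ 1) {z : ℝ} (hz : |z| < (3 * a - 1) / 2) :
    0 < bump a z := by
  have hpos : 0 < a := by linarith
  rw [← bump_abs hpos]
  set w := max |z| ((1 - a) / 2) with hw
  have h1 : bump a w ≤ bump a |z| := bump_antitoneOn ha.le ha1 ⟨abs_nonneg _, by linarith⟩
    ⟨le_max_of_le_left (abs_nonneg _), max_le (by linarith) (by linarith)⟩ (le_max_left _ _)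
  refine lt_of_lt_of_le ?_ h1
  have hlt : w < (3 * a - 1) / 2 := max_lt hz (by linarith)
  rw [bump_outer ha.le ha1 (le_max_right _ _) hlt.le]
  have h2 : 0 < 2 * π * (a - (1 - a) / 2 - w) / a := by
    have : 0 < a - (1 - a) / 2 - w := by linarith
    positivity
  have h3 := sin_lt h2
  rw [show 2 * π * (a - (1 - a) / 2 - w) / a = 2 * π - 2 * π * ((1 - a) / 2 + w) / a by field_simp; ring,
    sin_two_pi_sub] at h3
  have h4 : 0 < a / (4 * π) := by positivity
  have h5 : a / (4 * π) * (2 * π - 2 * π * ((1 - a) / 2 + w) / a) = (a - (1 - a) / 2 - w) / 2 := by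
    field_simp; ring
  nlinarith

theorem id_sub_sin_mono : Monotone fun x : ℝ => x - sin x := by
  apply monotone_of_deriv_nonneg (by fun_prop)
  intro x
  have : HasDerivAt (fun x : ℝ => x - sin x) (1 - cos x) x := (hasDerivAt_id x).sub (hasDerivAt_sin x)
  rw [this.deriv]; linarith [cos_le_one x]

/-- A hump dominates the squared cosine of the same height and of half-width `a / 2`. -/
theorem cos_sq_le_bump (ha : 1 / 2 ≤ a) (ha1 : a ≤ 1) {z : ℝ} (h0 : 0 ≤ z) (h1 : z ≤ a / 2) :
    bump a 0 * cos (π * z / a) ^ 2 ≤ bump a z := by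
  have hpos : 0 < a := by linarith
  obtain ⟨ψ, hψ⟩ : ∃ ψ, ψ = 2 * π * ((1 - a) / 2) / a := ⟨_, rfl⟩
  obtain ⟨φ, hφ⟩ : ∃ φ, φ = 2 * π * z / a := ⟨_, rfl⟩
  have hφ0 : 0 ≤ φ := by rw [hφ]; positivity
  have hφ1 : φ ≤ π := by rw [hφ, div_le_iff₀ hpos]; nlinarith [pi_pos]
  have hψ0 : 0 ≤ ψ := by
    have : 0 ≤ (1 - a) / 2 := by linarith
    rw [hψ]; positivity
  have hψ1 : ψ ≤ π := by rw [hψ, div_le_iff₀ hpos]; nlinarith [pi_pos]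
  have hc : cos (π * z / a) ^ 2 = (1 + cos φ) / 2 := by
    rw [cos_sq, hφ, show 2 * (π * z / a) = 2 * π * z / a by ring]; ring
  have k : 0 < a / (4 * π) := by positivity
  have e0 : bump a 0 = a / (4 * π) * (2 * (π - ψ + sin ψ)) := by
    rw [bump_inner ha ha1 le_rfl (by linarith), add_zero, sub_zero, ← hψ]
    have : (2 * a - 1) / 2 = a / (4 * π) * (2 * (π - ψ)) := by rw [hψ]; field_simp; ring
    rw [this]; ring
  have hsψ : sin ψ ≤ π - ψ := by
    rw [← sin_pi_sub]; exact sin_le (by linarith)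
  have hsψ0 : 0 ≤ sin ψ := sin_nonneg_of_nonneg_of_le_pi hψ0 hψ1
  have hcφ : cos φ ≤ 1 := cos_le_one _
  rw [hc, e0]
  rcases le_total z ((1 - a) / 2) with h | h
  · rw [bump_inner ha ha1 h0 h]
    have e1 : 2 * π * ((1 - a) / 2 + z) / a = ψ + φ := by rw [hψ, hφ]; ring
    have e2 : 2 * π * ((1 - a) / 2 - z) / a = ψ - φ := by rw [hψ, hφ]; ring
    have e3 : (2 * a - 1) / 2 = a / (4 * π) * (2 * (π - ψ)) := by rw [hψ]; field_simp; ring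
    rw [e1, e2, e3, sin_add, sin_sub, ← mul_add, ← mul_add, mul_assoc]
    apply mul_le_mul_of_nonneg_left _ k.le
    nlinarith
  · rw [bump_outer ha ha1 h (by linarith)]
    have e1 : 2 * π * ((1 - a) / 2 + z) / a = ψ + φ := by rw [hψ, hφ]; ring
    have e3 : (a - (1 - a) / 2 - z) / 2 = a / (4 * π) * (2 * π - ψ - φ) := by
      rw [hψ, hφ]; field_simp; ring
    rw [e1, e3, ← mul_add, mul_assoc]
    apply mul_le_mul_of_nonneg_left _ k.le
    have hle : ψ ≤ φ := by rw [hψ, hφ]; gcongr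
    -- the outer closed form is the inner one minus `t - sin t` at `t = φ - ψ`
    have e4 : sin (ψ + φ) = 2 * (sin ψ * cos φ) + sin (φ - ψ) := by rw [sin_add, sin_sub]; ring
    rw [e4]
    suffices (φ - ψ) - sin (φ - ψ) ≤ (π - ψ - sin ψ) * (1 - cos φ) by linarith
    rcases le_total (π / 2) φ with h2 | h2
    · have h3 : cos φ ≤ 0 := cos_nonpos_of_pi_div_two_le_of_le h2 (by linarith)
      have h4 : (φ - ψ) - sin (φ - ψ) ≤ (π - ψ) - sin (π - ψ) :=
        id_sub_sin_mono (by linarith : φ - ψ ≤ π - ψ)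
      rw [sin_pi_sub] at h4
      nlinarith
    · have h3 : (φ - ψ) * cos (φ - ψ) ≤ sin (φ - ψ) := by
        rcases (show φ - ψ ≤ π / 2 by linarith).eq_or_lt with h5 | h5
        · rw [h5]; simp
        · have hc0 : 0 < cos (φ - ψ) := cos_pos_of_mem_Ioo ⟨by linarith, h5⟩
          have := le_tan (by linarith : 0 ≤ φ - ψ) h5
          rwa [tan_eq_sin_div_cos, le_div_iff₀ hc0] at this
      have h4 : cos φ ≤ cos (φ - ψ) := cos_le_cos_of_nonneg_of_le_pi (by linarith) hφ1 (by linarith)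
      have h5 : φ - ψ ≤ π - ψ - sin ψ := by
        have := sin_le_one ψ
        have := pi_gt_three
        linarith
      nlinarith
end hump

/-! ### A superharmonic weight dominating the tails of `∑ 2 / x³` -/

/-- A weight with `2 / x³ + w(x + 1) ≤ w(x)`, hence `∑_{k ≥ 0} 2 / (x + k)³ ≤ w(x)`. -/
noncomputable def tailWeight (x : ℝ) : ℝ := 2 / x ^ 3 + 1 / (x + 1 / 2) ^ 2

/-- Minus a primitive of `tailWeight`. -/
noncomputable def tailPrim (x : ℝ) : ℝ := 1 / x ^ 2 + 1 / (x + 1 / 2)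

theorem tailWeight_pos {x : ℝ} (hx : 0 < x) : 0 < tailWeight x := by
  unfold tailWeight; positivity

theorem tailWeight_step {x : ℝ} (hx : 0 < x) : 2 / x ^ 3 + tailWeight (x + 1) ≤ tailWeight x := by
  unfold tailWeight
  rw [← sub_nonneg]
  have : 2 / x ^ 3 + 1 / (x + 1 / 2) ^ 2 - (2 / x ^ 3 + (2 / (x + 1) ^ 3 + 1 / (x + 1 + 1 / 2) ^ 2))
      = 1 / (x + 1 / 2) ^ 2 - 2 / (x + 1) ^ 3 - 1 / (x + 3 / 2) ^ 2 := by ring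
  rw [this, show x + 1 / 2 = (2 * x + 1) / 2 by ring, show x + 3 / 2 = (2 * x + 3) / 2 by ring]
  field_simp
  ring_nf
  positivity

theorem continuousOn_tailWeight : ContinuousOn tailWeight (Ioi 0) := by
  unfold tailWeight
  apply ContinuousOn.add <;> apply ContinuousOn.div (by fun_prop) (by fun_prop)
  · intro x hx; simp only [mem_Ioi] at hx; positivity
  · intro x hx; simp only [mem_Ioi] at hx; positivity

theorem tailWeight_antitoneOn : AntitoneOn tailWeight (Ioi 0) := by
  intro x hx y hy h
  simp only [mem_Ioi] at hx hy
  unfold tailWeight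
  gcongr

theorem hasDerivAt_tailPrim {x : ℝ} (hx : 0 < x) : HasDerivAt tailPrim (-tailWeight x) x := by
  have h1 : HasDerivAt (fun x : ℝ => (x ^ 2)⁻¹) (-(2 * x) / (x ^ 2) ^ 2) x :=
    ((hasDerivAt_pow 2 x).inv (by positivity)).congr_deriv (by simp)
  have h2 : HasDerivAt (fun x : ℝ => (x + 1 / 2)⁻¹) (-1 / (x + 1 / 2) ^ 2) x :=
    ((hasDerivAt_id x).add_const (1 / 2 : ℝ)).inv (by simp only [id]; positivity)
  have h3 := (h1.add h2).congr_of_eventuallyEq (f₁ := tailPrim)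
    (Eventually.of_forall fun y => by simp [tailPrim])
  refine h3.congr_deriv ?_
  unfold tailWeight
  field_simp
  ring

theorem intervalIntegrable_mul_tailWeight {f : ℝ → ℝ} (hf : Continuous f) {s t : ℝ} (hs : 0 < s)
    (ht : 0 < t) : IntervalIntegrable (fun x => f x * tailWeight x) volume s t := by
  apply ContinuousOn.intervalIntegrable
  apply hf.continuousOn.mul (continuousOn_tailWeight.mono _)
  intro x hx
  exact lt_of_lt_of_le (lt_min hs ht) hx.1

theorem integral_tailWeight {s t : ℝ} (hs : 0 < s) (ht : 0 < t) :
    ∫ x in s..t, tailWeight x = tailPrim s - tailPrim t := by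
  have hmem : ∀ x ∈ uIcc s t, 0 < x := fun x hx => lt_of_lt_of_le (lt_min hs ht) hx.1
  have := integral_eq_sub_of_hasDerivAt (a := s) (b := t) (f := fun x => -tailPrim x)
    (f' := tailWeight) (fun x hx => (hasDerivAt_tailPrim (hmem x hx)).neg.congr_deriv (neg_neg _))
    ((continuousOn_tailWeight.mono hmem).intervalIntegrable)
  rw [this]; ring

theorem tailPrim_anti {x y : ℝ} (hx : 0 < x) (h : x ≤ y) : tailPrim y ≤ tailPrim x := by
  unfold tailPrim; gcongr

theorem tailPrim_sub_anti {x y l : ℝ} (hx : 0 < x) (h : x ≤ y) (hl : 0 ≤ l) :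
    tailPrim y - tailPrim (y + l) ≤ tailPrim x - tailPrim (x + l) := by
  have hy : 0 < y := by linarith
  rw [← integral_tailWeight hy (by linarith), ← integral_tailWeight hx (by linarith)]
  have e : ∫ u in y..(y + l), tailWeight u = ∫ u in x..(x + l), tailWeight (u + (y - x)) := by
    rw [integral_comp_add_right]; congr 1 <;> ring
  rw [e]
  have hmem : ∀ u ∈ uIcc x (x + l), 0 < u := by
    intro u hu; rw [uIcc_of_le (by linarith)] at hu; linarith [hu.1]
  apply integral_mono_on (by linarith)
  · apply ContinuousOn.intervalIntegrable
    refine continuousOn_tailWeight.comp (by fun_prop) ?_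
    intro u hu
    have := hmem u hu
    simp only [mem_Ioi]; linarith
  · exact (continuousOn_tailWeight.mono hmem).intervalIntegrable
  · intro u hu
    have : 0 < u := by linarith [hu.1]
    exact tailWeight_antitoneOn this (by simp only [mem_Ioi]; linarith) (by linarith)

theorem integral_mul_tailWeight_le {f : ℝ → ℝ} (hf : Continuous f) {s t K : ℝ} (hs : 0 < s)
    (h : s ≤ t) (hK : ∀ x ∈ Icc s t, f x ≤ K) :
    ∫ x in s..t, f x * tailWeight x ≤ K * (tailPrim s - tailPrim t) := by
  rw [← integral_tailWeight hs (by linarith), ← intervalIntegral.integral_const_mul]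
  apply integral_mono_on h (intervalIntegrable_mul_tailWeight hf hs (by linarith))
    (intervalIntegrable_mul_tailWeight continuous_const hs (by linarith))
  intro x hx
  have := tailWeight_pos (by linarith [hx.1] : 0 < x)
  exact mul_le_mul_of_nonneg_right (hK x hx) this.le

/-- A function which vanishes beyond distance `l` of the left endpoint. -/
theorem integral_mul_tailWeight_le_left {f : ℝ → ℝ} (hf : Continuous f) {s t K l : ℝ} (hs : 0 < s)
    (h : s ≤ t) (hl : 0 ≤ l) (hK0 : 0 ≤ K) (hK : ∀ x ∈ Icc s t, f x ≤ K)
    (h0 : s + l < t → ∀ x ∈ Icc s t, s + l ≤ x → f x = 0) :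
    ∫ x in s..t, f x * tailWeight x ≤ K * (tailPrim s - tailPrim (s + l)) := by
  rcases le_or_gt t (s + l) with h1 | h1
  · refine (integral_mul_tailWeight_le hf hs h hK).trans ?_
    have := tailPrim_anti (by linarith : 0 < t) h1
    gcongr
  · rw [← integral_add_adjacent_intervals (b := s + l)
      (intervalIntegrable_mul_tailWeight hf hs (by linarith))
      (intervalIntegrable_mul_tailWeight hf (by linarith) (by linarith))]
    have e : ∫ x in (s + l)..t, f x * tailWeight x = 0 := by
      rw [integral_congr (g := fun _ => 0)]
      · simp
      · intro x hx
        rw [uIcc_of_le h1.le] at hx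
        simp only
        rw [h0 h1 x ⟨by linarith [hx.1], hx.2⟩ hx.1, zero_mul]
    rw [e, add_zero]
    exact integral_mul_tailWeight_le hf hs (by linarith)
      fun x hx => hK x ⟨hx.1, by linarith [hx.2]⟩

/-- A function which vanishes beyond distance `l` of the right endpoint. -/
theorem integral_mul_tailWeight_le_right {f : ℝ → ℝ} (hf : Continuous f) {s t K l : ℝ} (hs : 0 < s)
    (h : s ≤ t) (hl : 0 ≤ l) (hlt : l < t) (hK0 : 0 ≤ K) (hK : ∀ x ∈ Icc s t, f x ≤ K)
    (h0 : s < t - l → ∀ x ∈ Icc s t, x ≤ t - l → f x = 0) :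
    ∫ x in s..t, f x * tailWeight x ≤ K * (tailPrim (t - l) - tailPrim t) := by
  rcases le_or_gt (t - l) s with h1 | h1
  · refine (integral_mul_tailWeight_le hf hs h hK).trans ?_
    have := tailPrim_anti (by linarith : 0 < t - l) h1
    gcongr
  · rw [← integral_add_adjacent_intervals (b := t - l)
      (intervalIntegrable_mul_tailWeight hf hs (by linarith))
      (intervalIntegrable_mul_tailWeight hf (by linarith) (by linarith))]
    have e : ∫ x in s..(t - l), f x * tailWeight x = 0 := by
      rw [integral_congr (g := fun _ => 0)]
      · simp
      · intro x hx
        rw [uIcc_of_le h1.le] at hx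
        simp only
        rw [h0 h1 x ⟨hx.1, by linarith [hx.2]⟩ hx.2, zero_mul]
    rw [e, zero_add]
    exact integral_mul_tailWeight_le hf (by linarith) (by linarith)
      fun x hx => hK x ⟨by linarith [hx.1], hx.2⟩

/-! ### Rational inequalities for the primitive of the weight -/

/-- The factor `1.46 > 1 / 0.685` matches the bound of `cos_sq_sum_ge`; the integral of the weight
over `[t + 2/3, t + 1]` bounds, per unit of height, the price of any step that starts at `t`. -/
theorem weight_budget_before {t : ℝ} (ht : 7 / 6 ≤ t) :
    1.46 * (tailPrim (t + 2 / 3) - tailPrim (t + 1)) ≤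
      0.99 / t ^ 2 - (tailPrim t - tailPrim (t + 1 / 3)) := by
  obtain ⟨s, hs, rfl⟩ : ∃ s : ℝ, 0 ≤ s ∧ t = (7 + s) / 6 := ⟨6 * t - 7, by linarith, by ring⟩
  unfold tailPrim
  rw [show (7 + s) / 6 + 2 / 3 = (11 + s) / 6 by ring, show (7 + s) / 6 + 1 = (13 + s) / 6 by ring,
    show (7 + s) / 6 + 1 / 3 = (9 + s) / 6 by ring, show (11 + s) / 6 + 1 / 2 = (14 + s) / 6 by ring,
    show (13 + s) / 6 + 1 / 2 = (16 + s) / 6 by ring, show (9 + s) / 6 + 1 / 2 = (12 + s) / 6 by ring,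
    show (7 + s) / 6 + 1 / 2 = (10 + s) / 6 by ring, ← sub_nonneg]
  field_simp
  ring_nf
  positivity

/-- The factor `4/3` matches a sample point at which a hump has at least `3/4` of its height. -/
theorem weight_budget_after {t : ℝ} (ht : 7 / 6 ≤ t) :
    4 / 3 * (tailPrim t - tailPrim (t + 1 / 3)) ≤
      0.99 / t ^ 2 - (tailPrim (t + 2 / 3) - tailPrim (t + 1)) := by
  obtain ⟨s, hs, rfl⟩ : ∃ s : ℝ, 0 ≤ s ∧ t = (7 + s) / 6 := ⟨6 * t - 7, by linarith, by ring⟩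
  unfold tailPrim
  rw [show (7 + s) / 6 + 2 / 3 = (11 + s) / 6 by ring, show (7 + s) / 6 + 1 = (13 + s) / 6 by ring,
    show (7 + s) / 6 + 1 / 3 = (9 + s) / 6 by ring, show (11 + s) / 6 + 1 / 2 = (14 + s) / 6 by ring,
    show (13 + s) / 6 + 1 / 2 = (16 + s) / 6 by ring, show (9 + s) / 6 + 1 / 2 = (12 + s) / 6 by ring,
    show (7 + s) / 6 + 1 / 2 = (10 + s) / 6 by ring, ← sub_nonneg]
  field_simp
  ring_nf
  positivity

theorem weight_budget_after_late {t : ℝ} (ht : 11 / 6 ≤ t) :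
    1.46 * (tailPrim t - tailPrim (t + 1 / 3)) ≤
      0.99 / t ^ 2 - (tailPrim (t + 2 / 3) - tailPrim (t + 1)) := by
  obtain ⟨s, hs, rfl⟩ : ∃ s : ℝ, 0 ≤ s ∧ t = (11 + s) / 6 := ⟨6 * t - 11, by linarith, by ring⟩
  unfold tailPrim
  rw [show (11 + s) / 6 + 2 / 3 = (15 + s) / 6 by ring, show (11 + s) / 6 + 1 = (17 + s) / 6 by ring,
    show (11 + s) / 6 + 1 / 3 = (13 + s) / 6 by ring, show (15 + s) / 6 + 1 / 2 = (18 + s) / 6 by ring,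
    show (17 + s) / 6 + 1 / 2 = (20 + s) / 6 by ring, show (13 + s) / 6 + 1 / 2 = (16 + s) / 6 by ring,
    show (11 + s) / 6 + 1 / 2 = (14 + s) / 6 by ring, ← sub_nonneg]
  field_simp
  ring_nf
  positivity

/-- The variant for steps of which only the length `1/4` meets the hump, as an expansion in the
inverse of `t + 2/3`, the first position that can be reached next. -/
theorem weight_budget_before_short {t : ℝ} (ht : 7 / 6 ≤ t) :
    0.74 / (t + 2 / 3) ^ 2 + 0.78 / (t + 2 / 3) ^ 3 ≤
      0.99 / t ^ 2 - (tailPrim t - tailPrim (t + 1 / 4)) := by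
  obtain ⟨s, hs, rfl⟩ : ∃ s : ℝ, 0 ≤ s ∧ t = (14 + s) / 12 := ⟨12 * t - 14, by linarith, by ring⟩
  unfold tailPrim
  rw [show (14 + s) / 12 + 2 / 3 = (22 + s) / 12 by ring,
    show (14 + s) / 12 + 1 / 4 = (17 + s) / 12 by ring,
    show (17 + s) / 12 + 1 / 2 = (23 + s) / 12 by ring,
    show (14 + s) / 12 + 1 / 2 = (20 + s) / 12 by ring, ← sub_nonneg]
  field_simp
  ring_nf
  positivity

theorem weight_budget_after_short {t : ℝ} (ht : 11 / 6 ≤ t) :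
    0.74 / t ^ 2 + 0.15 / t ^ 3 ≤
      0.99 / t ^ 2 - (tailPrim (t + 3 / 4) - tailPrim (t + 1)) := by
  obtain ⟨s, hs, rfl⟩ : ∃ s : ℝ, 0 ≤ s ∧ t = (22 + s) / 12 := ⟨12 * t - 22, by linarith, by ring⟩
  unfold tailPrim
  rw [show (22 + s) / 12 + 3 / 4 = (31 + s) / 12 by ring,
    show (22 + s) / 12 + 1 = (34 + s) / 12 by ring,
    show (31 + s) / 12 + 1 / 2 = (37 + s) / 12 by ring,
    show (34 + s) / 12 + 1 / 2 = (40 + s) / 12 by ring, ← sub_nonneg]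
  field_simp
  ring_nf
  positivity

theorem weight_third_le {t : ℝ} (ht : 11 / 6 ≤ t) :
    tailPrim t - tailPrim (t + 1 / 3) ≤ (1 / 3) / t ^ 2 + 0.245 / t ^ 3 := by
  obtain ⟨s, hs, rfl⟩ : ∃ s : ℝ, 0 ≤ s ∧ t = (11 + s) / 6 := ⟨6 * t - 11, by linarith, by ring⟩
  unfold tailPrim
  rw [show (11 + s) / 6 + 1 / 3 = (13 + s) / 6 by ring,
    show (13 + s) / 6 + 1 / 2 = (16 + s) / 6 by ring,
    show (11 + s) / 6 + 1 / 2 = (14 + s) / 6 by ring, ← sub_nonneg]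
  field_simp
  ring_nf
  positivity

/-! ### Stepping down a hump: amortized cost of one record -/

/-- How much of the interval of length `1/3` that starts at distance `z` from the centre of a hump
and points away from it can meet the support of the hump. -/
noncomputable def reach (a z : ℝ) : ℝ := max 0 (min (1 / 3) ((3 * a - 1) / 2 - z))

/-- The credit kept after the running minimum has reached the point `z ∈ [-a, a)` (relative to the
centre of a hump) at the position `t` of the half-line. To the right of the centre it is what
remains of the budget `0.99 P / t²` after paying for the way from above, and serves to cross the
centre (it is dropped where the next step cannot cross). To the left of the centre it is the price of
the next step. -/
noncomputable def credit (a z t : ℝ) : ℝ :=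
  if 0 ≤ z then
    if z ≤ 1 / 3 then bump a z * (0.99 / t ^ 2 - (tailPrim t - tailPrim (t + reach a z))) else 0
  else bump a z * (tailPrim (t + 1 - reach a (-z)) - tailPrim (t + 1))

theorem reach_nonneg (a z : ℝ) : 0 ≤ reach a z := le_max_left _ _

theorem reach_le (a z : ℝ) : reach a z ≤ 1 / 3 := max_le (by norm_num) (min_le_left _ _)

theorem edge_le_add_reach {a z g : ℝ} (hg : g ≤ 1 / 3) (h : reach a z < g) :
    (3 * a - 1) / 2 ≤ z + reach a z := by
  unfold reach at *
  have h1 : min (1 / 3) ((3 * a - 1) / 2 - z) < 1 / 3 :=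
    lt_of_le_of_lt (le_max_right 0 _) (h.trans_le hg)
  have h2 : (3 * a - 1) / 2 - z < 1 / 3 := by
    rcases min_lt_iff.1 h1 with h | h
    · exact absurd h (lt_irrefl _)
    · exact h
  have := le_max_right 0 (min (1 / 3) ((3 * a - 1) / 2 - z))
  rw [min_eq_right h2.le] at *
  linarith

theorem tailPrim_reach_le {a z t : ℝ} (ht : 0 < t) :
    tailPrim t - tailPrim (t + reach a z) ≤ tailPrim t - tailPrim (t + 1 / 3) := by
  have := tailPrim_anti (by linarith [reach_nonneg a z] : 0 < t + reach a z)
    (by linarith [reach_le a z] : t + reach a z ≤ t + 1 / 3)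
  linarith

theorem tailPrim_reach_le' {a z t : ℝ} (ht : 0 < t) :
    tailPrim (t + 1 - reach a z) - tailPrim (t + 1) ≤ tailPrim (t + 2 / 3) - tailPrim (t + 1) := by
  have := tailPrim_anti (by linarith : 0 < t + 2 / 3)
    (by linarith [reach_le a z] : t + 2 / 3 ≤ t + 1 - reach a z)
  linarith

theorem tailPrim_third_le_budget {t : ℝ} (ht : 7 / 6 ≤ t) :
    tailPrim t - tailPrim (t + 1 / 3) ≤ 0.99 / t ^ 2 := by
  have h1 := weight_budget_before ht
  have h2 := tailPrim_anti (by linarith : 0 < t + 2 / 3) (by linarith : t + 2 / 3 ≤ t + 1)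
  linarith

section
variable {a : ℝ}

/-- The price of a step on the right of a centre, against the value at its lower end. -/
theorem right_part_le (ha : 1 / 2 ≤ a) (ha1 : a ≤ 1) {w g t : ℝ} (hw : 0 ≤ w) (hg0 : 0 ≤ g)
    (hg : g ≤ 1 / 3) (hwg : w + g ≤ a) (ht : 0 < t) :
    ∫ x in t..(t + g), bump a (w + (x - t)) * tailWeight x ≤
      bump a w * (tailPrim t - tailPrim (t + reach a w)) := by
  refine integral_mul_tailWeight_le_left (f := fun x => bump a (w + (x - t)))
    ((continuous_bump a).comp (by fun_prop)) ht (by linarith) (reach_nonneg _ _)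
    (bump_nonneg ha ha1 _) (fun x hx => ?_) (fun h x hx hx' => ?_)
  · exact bump_antitoneOn ha ha1 ⟨hw, by linarith⟩ ⟨by linarith [hx.1], by linarith [hx.2]⟩
      (by linarith [hx.1])
  · have := edge_le_add_reach hg (by linarith : reach a w < g)
    exact bump_eq_of_edge ha ha1 (by linarith) (by linarith [hx.2])

/-- The price of a step on the left of a centre, against the value at its upper end. -/
theorem left_part_le (ha : 1 / 2 ≤ a) (ha1 : a ≤ 1) {z g e t : ℝ} (hz : z ≤ 0) (hg0 : 0 ≤ g)
    (hg : g ≤ 1 / 3) (hzg : -a ≤ z - g) (ht : 0 < t) (hte : t + 1 ≤ e) :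
    ∫ x in (e - g)..e, bump a (z - (e - x)) * tailWeight x ≤
      bump a z * (tailPrim (t + 1 - reach a (-z)) - tailPrim (t + 1)) := by
  have hpos : 0 < a := by linarith
  have hr := reach_le a (-z)
  have hr0 := reach_nonneg a (-z)
  have h1 := integral_mul_tailWeight_le_right (f := fun x => bump a (z - (e - x))) (s := e - g)
    (t := e) (K := bump a z) (l := reach a (-z))
    ((continuous_bump a).comp (by fun_prop)) (by linarith : 0 < e - g) (by linarith)
    (reach_nonneg a (-z)) (by linarith)
    (bump_nonneg ha ha1 z) (fun x hx => ?_) (fun h x hx hx' => ?_)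
  · refine h1.trans ?_
    have h2 := tailPrim_sub_anti (by linarith : 0 < t + 1 - reach a (-z))
      (by linarith : t + 1 - reach a (-z) ≤ e - reach a (-z)) hr0
    rw [sub_add_cancel, sub_add_cancel] at h2
    exact mul_le_mul_of_nonneg_left h2 (bump_nonneg ha ha1 z)
  · rw [← bump_neg hpos, ← bump_neg hpos z]
    exact bump_antitoneOn ha ha1 ⟨by linarith, by linarith⟩
      ⟨by linarith [hx.2], by linarith [hx.1]⟩ (by linarith [hx.2])
  · have := edge_le_add_reach hg (by linarith : reach a (-z) < g)
    rw [← bump_neg hpos]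
    exact bump_eq_of_edge ha ha1 (by linarith) (by linarith [hx.1])

/-- A weighted sum of `cos²` at two points at distance at most `1/3`; the condition on the weights
is the one under which the minimum over the worst case `α + β = 1/3` is at least `s`. -/
theorem cos_sq_pair {c₁ c₂ s α β : ℝ} (hc₂ : 0 ≤ c₂)
    (hs : 0 ≤ c₁ + c₂ - 2 * s) (h : c₁ ^ 2 + c₂ ^ 2 - c₁ * c₂ ≤ (c₁ + c₂ - 2 * s) ^ 2)
    (hα : 1 / 12 ≤ α) (hβ : 0 ≤ β) (hαβ : α + β ≤ 1 / 3) :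
    s ≤ c₁ * cos (2 * π * α) ^ 2 + c₂ * cos (2 * π * β) ^ 2 := by
  have hp := pi_pos
  have hB : cos (4 * π / 3 - 4 * π * α) ≤ cos (4 * π * β) := by
    apply cos_le_cos_of_nonneg_of_le_pi (by positivity) <;> nlinarith
  have hB' : cos (4 * π / 3 - 4 * π * α) =
      -(1 / 2) * cos (4 * π * α) - √3 / 2 * sin (4 * π * α) := by
    rw [cos_sub, show 4 * π / 3 = π / 3 + π by ring, cos_add_pi, sin_add_pi, cos_pi_div_three,
      sin_pi_div_three]
    ring
  rw [cos_sq, cos_sq, show 2 * (2 * π * α) = 4 * π * α by ring,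
    show 2 * (2 * π * β) = 4 * π * β by ring]
  have h3 : (√3) ^ 2 = 3 := sq_sqrt (by norm_num)
  have hcs := sin_sq_add_cos_sq (4 * π * α)
  set c := cos (4 * π * α)
  set d := sin (4 * π * α)
  -- Cauchy–Schwarz for the pair `(cos, sin)`
  have key : -((c₁ - c₂ / 2) * c - √3 / 2 * c₂ * d) ≤ c₁ + c₂ - 2 * s := by
    refine le_of_abs_le (abs_le_of_sq_le_sq (le_trans ?_ h) hs)
    have : c₁ ^ 2 + c₂ ^ 2 - c₁ * c₂ - (-((c₁ - c₂ / 2) * c - √3 / 2 * c₂ * d)) ^ 2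
        = ((c₁ - c₂ / 2) * d + √3 / 2 * c₂ * c) ^ 2
          + (c₁ ^ 2 + c₂ ^ 2 - c₁ * c₂) * (1 - (d ^ 2 + c ^ 2))
          - (3 - (√3) ^ 2) / 4 * c₂ ^ 2 * (0 - (d ^ 2 + c ^ 2)) := by ring
    rw [hcs, h3] at this
    nlinarith [sq_nonneg ((c₁ - c₂ / 2) * d + √3 / 2 * c₂ * c)]
  have : c₂ * cos (4 * π / 3 - 4 * π * α) ≤ c₂ * cos (4 * π * β) := by gcongr
  rw [hB'] at this
  linarith

theorem cos_sq_sum_ge (ha : 5 / 9 ≤ a) {α β : ℝ} (hα : 0 ≤ α) (hβ : 0 ≤ β) (h : α + β ≤ 1 / 3) :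
    0.685 ≤ cos (π * α / a) ^ 2 + cos (π * β / a) ^ 2 := by
  have hpos : 0 < a := by linarith
  obtain ⟨m, hm⟩ : ∃ m, m = π * (α + β) / a := ⟨_, rfl⟩
  obtain ⟨d, hd⟩ : ∃ d, d = π * (α - β) / a := ⟨_, rfl⟩
  have e : cos (π * α / a) ^ 2 + cos (π * β / a) ^ 2 = 1 + cos m * cos d := by
    rw [cos_sq, cos_sq, show 2 * (π * α / a) = m + d by rw [hm, hd]; ring,
      show 2 * (π * β / a) = m - d by rw [hm, hd]; ring, cos_add, cos_sub]
    ring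
  have hm0 : 0 ≤ m := by rw [hm]; positivity
  have hm1 : m ≤ 3 / 5 * π := by rw [hm, div_le_iff₀ hpos]; nlinarith [pi_pos]
  have hdm : |d| ≤ m := by
    rw [hd, hm, abs_le]
    constructor
    · rw [← neg_div]
      gcongr
      nlinarith [pi_pos]
    · gcongr; linarith
  rw [e]
  have hp := pi_lt_d2
  have hp0 := pi_pos
  rcases le_total m (π / 2) with h1 | h1
  · have c1 : 0 ≤ cos m := cos_nonneg_of_neg_pi_div_two_le_of_le (by linarith) h1
    have c2 : 0 ≤ cos d := by
      rw [abs_le] at hdm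
      exact cos_nonneg_of_neg_pi_div_two_le_of_le (by linarith) (by linarith)
    nlinarith
  · have c1 : -(m - π / 2) ≤ cos m := by
      have := sin_le (by linarith : 0 ≤ m - π / 2)
      rw [sin_sub_pi_div_two] at this
      linarith
    have c2 : cos m ≤ 0 := cos_nonpos_of_pi_div_two_le_of_le h1 (by linarith)
    have := cos_le_one d
    nlinarith

theorem three_quarters_le_bump (ha : 1 / 2 ≤ a) (ha1 : a ≤ 1) {z : ℝ} (h0 : 0 ≤ z)
    (h1 : z ≤ 1 / 12) : bump a 0 * (3 / 4) ≤ bump a z := by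
  refine le_trans ?_ (cos_sq_le_bump ha ha1 h0 (by linarith))
  apply mul_le_mul_of_nonneg_left _ (bump_nonneg ha ha1 _)
  have hpos : 0 < a := by linarith
  have h2 : cos (π / 6) ≤ cos (π * z / a) := by
    apply cos_le_cos_of_nonneg_of_le_pi (by positivity) (by linarith [pi_pos])
    rw [div_le_iff₀ hpos]; nlinarith [pi_pos]
  have h3 : 0 ≤ cos (π / 6) := by rw [cos_pi_div_six]; positivity
  have h4 : cos (π / 6) ^ 2 = 3 / 4 := by
    rw [cos_pi_div_six, div_pow, sq_sqrt (by norm_num)]; norm_num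
  rw [← h4]
  gcongr

/-- The lower bound of `cos_sq_le_bump` with `a` replaced by `1/2`, where it is weakest. -/
theorem cos_sq_le_bump' (ha : 1 / 2 ≤ a) (ha1 : a ≤ 1) {z : ℝ} (h0 : 0 ≤ z) (h1 : z ≤ 1 / 4) :
    bump a 0 * cos (2 * π * z) ^ 2 ≤ bump a z := by
  refine le_trans ?_ (cos_sq_le_bump ha ha1 h0 (by linarith))
  apply mul_le_mul_of_nonneg_left _ (bump_nonneg ha ha1 _)
  have hpos : 0 < a := by linarith
  have h2 : cos (2 * π * z) ≤ cos (π * z / a) := by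
    apply cos_le_cos_of_nonneg_of_le_pi (by positivity) (by nlinarith [pi_pos])
    rw [div_le_iff₀ hpos]
    have : 0 ≤ π * z := by positivity
    nlinarith
  have h3 : 0 ≤ cos (2 * π * z) := by
    apply cos_nonneg_of_neg_pi_div_two_le_of_le <;> nlinarith [pi_pos]
  gcongr

/-- The price of a step across the centre of a hump is covered by the credit left before it and the
budget gained after it. The two sample points are at distances `α`, `β` from the centre; if one of
them is small, the corresponding sample alone suffices, and otherwise both are needed. -/
theorem straddle_le (ha : 1 / 2 ≤ a) (ha1 : a ≤ 1) {α β t t' : ℝ} (hα : 0 ≤ α) (hβ : 0 ≤ β)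
    (h : α + β ≤ 1 / 3) (ht : 0 < t) (ht' : 7 / 6 ≤ t') (htt : t + 2 / 3 ≤ t')
    (hgood : α < (3 * a - 1) / 2 → 7 / 6 ≤ t) :
    bump a 0 * (tailPrim t' - tailPrim (t' + 1 / 3)) ≤
      bump a α * (0.99 / t ^ 2 - (tailPrim t - tailPrim (t + reach a α))) +
      bump a β * (0.99 / t' ^ 2 - (tailPrim (t' + 1 - reach a β) - tailPrim (t' + 1))) := by
  have hM := bump_nonneg ha ha1 0
  have hX := bump_nonneg ha ha1 α
  have hY := bump_nonneg ha ha1 β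
  have hs0 : 0 ≤ tailPrim t' - tailPrim (t' + 1 / 3) := by
    have := tailPrim_anti (by linarith : 0 < t') (by linarith : t' ≤ t' + 1 / 3)
    linarith
  have hr1 := tailPrim_reach_le (a := a) (z := α) ht
  have hr2 := tailPrim_reach_le' (a := a) (z := β) (by linarith : 0 < t')
  have hN3 := weight_budget_after ht'
  have hsl : tailPrim t' - tailPrim (t' + 1 / 3) ≤ tailPrim (t + 2 / 3) - tailPrim (t + 1) := by
    have := tailPrim_sub_anti (by linarith : 0 < t + 2 / 3) htt (by norm_num : (0 : ℝ) ≤ 1 / 3)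
    rwa [show t + 2 / 3 + 1 / 3 = t + 1 by ring] at this
  rcases le_or_gt β (1 / 12) with hb | hb
  · have h1 := three_quarters_le_bump ha ha1 hβ hb
    have h2 : 0 ≤ bump a α * (0.99 / t ^ 2 - (tailPrim t - tailPrim (t + reach a α))) := by
      rcases lt_or_ge α ((3 * a - 1) / 2) with hl | hl
      · have := tailPrim_third_le_budget (hgood hl)
        exact mul_nonneg hX (by linarith)
      · rw [bump_eq_of_edge ha ha1 hl (by linarith)]; simp
    have h3 : bump a 0 * (tailPrim t' - tailPrim (t' + 1 / 3)) ≤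
        bump a β * (0.99 / t' ^ 2 - (tailPrim (t' + 1 - reach a β) - tailPrim (t' + 1))) := by
      calc _ = bump a 0 * (3 / 4) * (4 / 3 * (tailPrim t' - tailPrim (t' + 1 / 3))) := by ring
        _ ≤ _ := by
          apply mul_le_mul h1 (by linarith) (by positivity) hY
    linarith
  have hα4 : α ≤ 1 / 4 := by linarith
  have ht7 : 7 / 6 ≤ t := hgood (by linarith)
  have ht11 : 11 / 6 ≤ t' := by linarith
  have hN5a := weight_budget_before ht7
  have hN5b := weight_budget_after_late ht11
  rcases le_or_gt α (1 / 12) with hc | hc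
  · have h1 := three_quarters_le_bump ha ha1 hα hc
    have h2 : 0 ≤ bump a β * (0.99 / t' ^ 2 - (tailPrim (t' + 1 - reach a β) - tailPrim (t' + 1))) :=
      mul_nonneg hY (by linarith)
    have h3 : bump a 0 * (tailPrim t' - tailPrim (t' + 1 / 3)) ≤
        bump a α * (0.99 / t ^ 2 - (tailPrim t - tailPrim (t + reach a α))) := by
      calc _ = bump a 0 * (3 / 4) * (4 / 3 * (tailPrim t' - tailPrim (t' + 1 / 3))) := by ring
        _ ≤ _ := by
          apply mul_le_mul h1 (by linarith) (by positivity) hX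
    linarith
  have hβ4 : β ≤ 1 / 4 := by linarith
  rcases le_or_gt (5 / 9) a with h59 | h59
  · have hXY : bump a 0 * 0.685 ≤ bump a α + bump a β := by
      have e1 := cos_sq_le_bump ha ha1 hα (by linarith)
      have e2 := cos_sq_le_bump ha ha1 hβ (by linarith)
      have e3 := mul_le_mul_of_nonneg_left (cos_sq_sum_ge h59 hα hβ h) hM
      linarith
    set s := tailPrim t' - tailPrim (t' + 1 / 3)
    calc bump a 0 * s ≤ bump a 0 * 0.685 * (1.46 * s) := by nlinarith [mul_nonneg hM hs0]
      _ ≤ (bump a α + bump a β) * (1.46 * s) := by gcongr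
      _ = bump a α * (1.46 * s) + bump a β * (1.46 * s) := by ring
      _ ≤ _ := by
        gcongr
        · linarith
        · linarith
  · have hre : ∀ {z : ℝ}, 1 / 12 < z → reach a z ≤ 1 / 4 := by
      intro z hz
      exact max_le (by norm_num) ((min_le_right _ _).trans (by linarith))
    have ra : tailPrim t - tailPrim (t + reach a α) ≤ tailPrim t - tailPrim (t + 1 / 4) := by
      have := tailPrim_anti (by linarith [reach_nonneg a α] : 0 < t + reach a α)
        (by linarith [hre hc] : t + reach a α ≤ t + 1 / 4)
      linarith
    have rb : tailPrim (t' + 1 - reach a β) - tailPrim (t' + 1) ≤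
        tailPrim (t' + 3 / 4) - tailPrim (t' + 1) := by
      have := tailPrim_anti (by linarith : 0 < t' + 3 / 4)
        (by linarith [hre hb] : t' + 3 / 4 ≤ t' + 1 - reach a β)
      linarith
    obtain ⟨k, hk⟩ : ∃ k, k = 1 / t' := ⟨_, rfl⟩
    have hk0 : 0 < k := by rw [hk]; positivity
    have hk1 : k ≤ 6 / 11 := by
      rw [hk, div_le_div_iff₀ (by linarith) (by norm_num)]; linarith
    have b1 : k ^ 2 * (0.74 + 0.78 * k) ≤
        0.99 / t ^ 2 - (tailPrim t - tailPrim (t + reach a α)) := by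
      have e := weight_budget_before_short ht7
      have : k ^ 2 * (0.74 + 0.78 * k) = 0.74 / t' ^ 2 + 0.78 / t' ^ 3 := by
        rw [hk]; field_simp
      have e2 : 0.74 / t' ^ 2 + 0.78 / t' ^ 3 ≤ 0.74 / (t + 2 / 3) ^ 2 + 0.78 / (t + 2 / 3) ^ 3 := by
        gcongr
      linarith
    have b2 : k ^ 2 * (0.74 + 0.15 * k) ≤
        0.99 / t' ^ 2 - (tailPrim (t' + 1 - reach a β) - tailPrim (t' + 1)) := by
      have e := weight_budget_after_short ht11
      have : k ^ 2 * (0.74 + 0.15 * k) = 0.74 / t' ^ 2 + 0.15 / t' ^ 3 := by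
        rw [hk]; field_simp
      linarith
    have b3 : tailPrim t' - tailPrim (t' + 1 / 3) ≤ k ^ 2 * (1 / 3 + 0.245 * k) := by
      have e := weight_third_le ht11
      have : k ^ 2 * (1 / 3 + 0.245 * k) = (1 / 3) / t' ^ 2 + 0.245 / t' ^ 3 := by
        rw [hk]; field_simp
      linarith
    have hquad : (0.74 + 0.78 * k) ^ 2 + (0.74 + 0.15 * k) ^ 2 - (0.74 + 0.78 * k) * (0.74 + 0.15 * k)
        ≤ ((0.74 + 0.78 * k) + (0.74 + 0.15 * k) - 2 * (1 / 3 + 0.245 * k)) ^ 2 := by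
      have := mul_nonneg hk0.le (sub_nonneg.2 hk1)
      linarith
    have hell : 1 / 3 + 0.245 * k ≤ (0.74 + 0.78 * k) * cos (2 * π * α) ^ 2 +
        (0.74 + 0.15 * k) * cos (2 * π * β) ^ 2 := by
      apply cos_sq_pair (by positivity) (by linarith) hquad hc.le hβ h
    have x1 := cos_sq_le_bump' ha ha1 hα hα4
    have x2 := cos_sq_le_bump' ha ha1 hβ hβ4
    calc bump a 0 * (tailPrim t' - tailPrim (t' + 1 / 3))
        ≤ bump a 0 * (k ^ 2 * (1 / 3 + 0.245 * k)) := by gcongr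
      _ ≤ bump a 0 * (k ^ 2 * ((0.74 + 0.78 * k) * cos (2 * π * α) ^ 2 +
        (0.74 + 0.15 * k) * cos (2 * π * β) ^ 2)) := by gcongr
      _ = bump a 0 * cos (2 * π * α) ^ 2 * (k ^ 2 * (0.74 + 0.78 * k)) +
          bump a 0 * cos (2 * π * β) ^ 2 * (k ^ 2 * (0.74 + 0.15 * k)) := by ring
      _ ≤ bump a α * (k ^ 2 * (0.74 + 0.78 * k)) + bump a β * (k ^ 2 * (0.74 + 0.15 * k)) := by
        gcongr
      _ ≤ _ := by gcongr

theorem credit_nonneg (ha : 1 / 2 ≤ a) (ha1 : a ≤ 1) {z t : ℝ} (ht : 0 < t)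
    (hz : z < a) (hgood : 0 ≤ z → z ≤ 1 / 3 → z < (3 * a - 1) / 2 → 7 / 6 ≤ t) :
    0 ≤ credit a z t := by
  unfold credit
  split_ifs with h0 h1
  · rcases lt_or_ge z ((3 * a - 1) / 2) with hl | hl
    · have := tailPrim_third_le_budget (hgood h0 h1 hl)
      have := tailPrim_reach_le (a := a) (z := z) ht
      exact mul_nonneg (bump_nonneg ha ha1 z) (by linarith)
    · rw [bump_eq_of_edge ha ha1 hl hz.le]; simp
  · exact le_rfl
  · apply mul_nonneg (bump_nonneg ha ha1 z)
    rw [sub_nonneg]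
    exact tailPrim_anti (by linarith [reach_le a (-z)]) (by linarith [reach_nonneg a (-z)])

/-- One step down, from the point `z` at position `t` to the point `w` at position `t'`: the price
of the step and the new credit are covered by the old credit and the new budget. -/
theorem credit_step (ha : 1 / 2 ≤ a) (ha1 : a ≤ 1) {z w g t t' : ℝ} (hz0 : -a ≤ z) (hz1 : z < a)
    (hw0 : -a ≤ w) (hw1 : w < a) (hg0 : 0 < g) (hg : g ≤ 1 / 3)
    (hw : w = z - g ∨ w = z - g + 2 * a) (ht : 0 < t) (ht' : 7 / 6 ≤ t') (htt : t + 1 - g ≤ t')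
    (hgood : 0 ≤ z → z ≤ 1 / 3 → z < (3 * a - 1) / 2 → 7 / 6 ≤ t) :
    (∫ x in t'..(t' + g), bump a (w + (x - t')) * tailWeight x) + credit a w t' ≤
      0.99 * bump a w / t' ^ 2 + credit a z t := by
  have hpos : 0 < a := by linarith
  have ht'0 : 0 < t' := by linarith
  have hwn := bump_nonneg ha ha1 w
  have hN1 := tailPrim_third_le_budget ht'
  have hc0 := credit_nonneg ha ha1 ht hz1 hgood
  have hB : 0.99 * bump a w / t' ^ 2 = bump a w * (0.99 / t' ^ 2) := by ring
  rw [hB]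
  have cright : 0 ≤ w → bump a w * (tailPrim t' - tailPrim (t' + reach a w)) + credit a w t' ≤
      bump a w * (0.99 / t' ^ 2) := by
    intro h0
    have hr := tailPrim_reach_le (a := a) (z := w) ht'0
    unfold credit
    rw [if_pos h0]
    split_ifs
    · apply le_of_eq; ring
    · rw [add_zero]; exact mul_le_mul_of_nonneg_left (by linarith) hwn
  have cz : z < 0 → credit a z t =
      bump a z * (tailPrim (t + 1 - reach a (-z)) - tailPrim (t + 1)) := by
    intro h; unfold credit; rw [if_neg (not_le.2 h)]
  rcases hw with hw | hw
  · rcases le_or_gt 0 w with h0 | h0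
    · have h1 := right_part_le ha ha1 h0 hg0.le hg (by linarith) ht'0
      linarith [cright h0]
    · have cw : credit a w t' = bump a w * (tailPrim (t' + 1 - reach a (-w)) - tailPrim (t' + 1)) := by
        unfold credit; rw [if_neg (not_le.2 h0)]
      rcases le_or_gt 0 z with hz | hz
      · have h1 := straddle_le ha ha1 hz (by linarith : 0 ≤ -w) (by linarith) ht ht' (by linarith)
          (hgood hz (by linarith))
        have h2 := integral_mul_tailWeight_le (f := fun x => bump a (w + (x - t')))
          ((continuous_bump a).comp (by fun_prop)) ht'0 (by linarith : t' ≤ t' + g)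
          (fun x _ => bump_le_center ha ha1 _)
        have h3 : bump a 0 * (tailPrim t' - tailPrim (t' + g)) ≤
            bump a 0 * (tailPrim t' - tailPrim (t' + 1 / 3)) := by
          apply mul_le_mul_of_nonneg_left _ (bump_nonneg ha ha1 0)
          linarith [tailPrim_anti (by linarith : 0 < t' + g) (by linarith : t' + g ≤ t' + 1 / 3)]
        have cz' : credit a z t =
            bump a z * (0.99 / t ^ 2 - (tailPrim t - tailPrim (t + reach a z))) := by
          unfold credit; rw [if_pos hz, if_pos (by linarith)]
        rw [bump_neg hpos] at h1
        rw [cw, cz']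
        linarith
      · have h1 := left_part_le ha ha1 hz.le hg0.le hg (by linarith) ht
          (by linarith : t + 1 ≤ t' + g)
        have e : (fun x => bump a (w + (x - t')) * tailWeight x) =
            fun x => bump a (z - (t' + g - x)) * tailWeight x := by
          funext x; congr 2; rw [hw]; ring
        rw [e, cw, cz hz]
        rw [add_sub_cancel_right] at h1
        have h2 := tailPrim_reach_le' (a := a) (z := -w) ht'0
        have h3 := weight_budget_after ht'
        have h4 := tailPrim_anti ht'0 (by linarith : t' ≤ t' + 1 / 3)
        have h5 : bump a w * (tailPrim (t' + 1 - reach a (-w)) - tailPrim (t' + 1)) ≤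
            bump a w * (0.99 / t' ^ 2) := mul_le_mul_of_nonneg_left (by linarith) hwn
        linarith
  · have hz : z < 0 := by linarith
    have h0 : 0 ≤ w := by linarith
    have h1 := right_part_le ha ha1 h0 (by linarith : 0 ≤ a - w) (by linarith) (by linarith) ht'0
    have h2 := left_part_le ha ha1 hz.le (by linarith : 0 ≤ z + a) (by linarith) (by linarith) ht
      (by linarith : t + 1 ≤ t' + g)
    have hc : Continuous fun x => bump a (w + (x - t')) := (continuous_bump a).comp (by fun_prop)
    rw [← integral_add_adjacent_intervals (b := t' + (a - w))
      (intervalIntegrable_mul_tailWeight hc ht'0 (by linarith))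
      (intervalIntegrable_mul_tailWeight hc (by linarith) (by linarith))]
    have e : (fun x => bump a (z - (t' + g - x)) * tailWeight x) =
        fun x => bump a (w + (x - t')) * tailWeight x := by
      funext x
      congr 1
      rw [← bump_add_period hpos]
      congr 1; rw [hw]; ring
    rw [e, show t' + g - (z + a) = t' + (a - w) by rw [hw]; ring] at h2
    rw [cz hz]
    linarith [cright h0]
end

/-! ### Charging the descent of the running minimum -/

/-- The running minimum `min(0, u₁, …, u_n)`. -/
noncomputable def runMin (u : ℕ → ℝ) : ℕ → ℝ
  | 0 => 0
  | n + 1 => min (runMin u n) (u (n + 1))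

theorem runMin_le_zero (u : ℕ → ℝ) (n : ℕ) : runMin u n ≤ 0 := by
  induction n with
  | zero => exact le_rfl
  | succ n ih => exact (min_le_left _ _).trans ih

theorem runMin_le (u : ℕ → ℝ) {n : ℕ} (hn : 1 ≤ n) : runMin u n ≤ u n := by
  obtain ⟨k, rfl⟩ := Nat.exists_eq_add_of_le' hn
  exact min_le_right _ _

theorem add_runMin_pos {u : ℕ → ℝ} (hu : ∀ n : ℕ, 1 ≤ n → 0 < n + u n) {n : ℕ} (hn : 1 ≤ n) :
    0 < n + runMin u n := by
  induction n, hn using Nat.le_induction with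
  | base =>
    have := hu 1 le_rfl
    simp only [runMin, Nat.cast_one] at *
    rcases min_choice 0 (u (0 + 1)) with h | h <;> rw [h]
    · norm_num
    · simpa using this
  | succ n hn ih =>
    have := hu (n + 1) (by omega)
    simp only [runMin]
    push_cast at *
    rcases min_choice (runMin u n) (u (n + 1)) with h | h <;> rw [h] <;> linarith

section
variable {a : ℝ}

theorem humpPrim_nonneg (ha : 1 / 2 ≤ a) (ha1 : a ≤ 1) (u : ℝ) : 0 ≤ humpPrim a u := by
  rw [humpPrim_eq_bump]; exact bump_nonneg ha ha1 _

theorem humpPrim_eq_zero (ha : 1 / 2 ≤ a) (ha1 : a ≤ 1) {y : ℝ} (h0 : a - 1 ≤ y) (h1 : y ≤ 0) :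
    humpPrim a y = 0 := by
  have hpos : 0 < a := by linarith
  rw [humpPrim_eq_bump]
  rcases le_total (y + (a + 1) / 2) a with h | h
  · exact bump_eq_of_edge ha ha1 (by linarith) h
  · rw [← bump_neg hpos, ← bump_add_period hpos]
    exact bump_eq_of_edge ha ha1 (by linarith) (by linarith)

theorem intervalIntegrable_humpPrim_mul_tailWeight {N s t : ℝ} (hs : 0 < N + s) (ht : 0 < N + t) :
    IntervalIntegrable (fun y => humpPrim a y * tailWeight (N + y)) volume s t := by
  apply ContinuousOn.intervalIntegrable
  apply (continuous_humpPrim a).continuousOn.mul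
  refine continuousOn_tailWeight.comp (by fun_prop) ?_
  intro x hx
  have : min s t ≤ x := hx.1
  simp only [mem_Ioi]
  rcases min_choice s t with h | h <;> rw [h] at this <;> linarith

theorem intervalIntegrable_humpPrim_div {N s t : ℝ} (hs : 0 < N + s) (ht : 0 < N + t) :
    IntervalIntegrable (fun y => humpPrim a y * (2 / (N + y) ^ 3)) volume s t := by
  apply ContinuousOn.intervalIntegrable
  apply (continuous_humpPrim a).continuousOn.mul
  refine ContinuousOn.div (by fun_prop) (by fun_prop) ?_
  intro x hx
  have : min s t ≤ x := hx.1
  have : 0 < N + x := by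
    rcases min_choice s t with h | h <;> rw [h] at this <;> linarith
  positivity

/-- The price of the first step. If `τ₁ < a` then `a > 2/π`, and the constraint `τ₁ ≥ 2/π` makes
the price affordable. -/
theorem first_step_le (ha : 1 / 2 ≤ a) (ha1 : a ≤ 1) {v : ℝ} (hv0 : 2 / π - 1 ≤ v)
    (hv1 : v < a - 1) :
    ∫ y in v..0, humpPrim a y * tailWeight (1 + y) ≤ 0.99 * (humpPrim a v / (1 + v) ^ 2) := by
  have hpos : 0 < a := by linarith
  have hπ : 0.63 < 2 / π := by
    rw [lt_div_iff₀ pi_pos]; linarith [pi_lt_d2]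
  have ht : 0.63 < 1 + v := by linarith
  rw [← integral_add_adjacent_intervals (b := a - 1)
    (intervalIntegrable_humpPrim_mul_tailWeight (by linarith) (by linarith))
    (intervalIntegrable_humpPrim_mul_tailWeight (by linarith) (by linarith))]
  have e0 : ∫ y in (a - 1)..0, humpPrim a y * tailWeight (1 + y) = 0 := by
    rw [integral_congr (g := fun _ => 0)]
    · simp
    · intro y hy
      rw [uIcc_of_le (by linarith)] at hy
      simp only
      rw [humpPrim_eq_zero ha ha1 hy.1 hy.2, zero_mul]
  rw [e0, add_zero]
  have e1 : ∫ y in v..(a - 1), humpPrim a y * tailWeight (1 + y) =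
      ∫ x in (1 + v)..a, humpPrim a (x - 1) * tailWeight x := by
    have := integral_comp_add_left (a := v) (b := a - 1)
      (fun x => humpPrim a (x - 1) * tailWeight x) 1
    simp only [add_sub_cancel_left, add_sub_cancel] at this
    exact this
  rw [e1]
  have h1 := integral_mul_tailWeight_le (f := fun x => humpPrim a (x - 1)) (K := humpPrim a v)
    ((continuous_humpPrim a).comp (by fun_prop)) (by linarith : 0 < 1 + v)
    (by linarith : 1 + v ≤ a) (fun x hx => by
      rw [humpPrim_eq_bump, humpPrim_eq_bump]
      rcases le_total (x - 1 + (a + 1) / 2) a with h | h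
      · exact bump_antitoneOn ha ha1 ⟨by linarith, by linarith⟩ ⟨by linarith [hx.1], h⟩
          (by linarith [hx.1])
      · rw [← humpPrim_eq_bump, humpPrim_eq_zero ha ha1 (by linarith) (by linarith [hx.2])]
        exact bump_nonneg ha ha1 _)
  refine h1.trans ?_
  rw [show 0.99 * (humpPrim a v / (1 + v) ^ 2) = humpPrim a v * (0.99 / (1 + v) ^ 2) by ring]
  apply mul_le_mul_of_nonneg_left _ (humpPrim_nonneg ha ha1 v)
  unfold tailPrim
  have b1 : 1 ≤ 1 / a ^ 2 := by
    rw [le_div_iff₀ (by positivity)]; nlinarith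
  have b2 : 1 / (1 + v + 1 / 2) ≤ 1 := by
    rw [div_le_one (by linarith)]; linarith
  have b3 : 1 / 2 ≤ 1 / (a + 1 / 2) := by
    rw [div_le_div_iff₀ (by norm_num) (by linarith)]; linarith
  have b4 : 0.01 / (1 + v) ^ 2 ≤ 1 / 2 := by
    rw [div_le_div_iff₀ (by positivity) (by norm_num)]; nlinarith
  have b5 : 1 / (1 + v) ^ 2 = 0.99 / (1 + v) ^ 2 + 0.01 / (1 + v) ^ 2 := by ring
  linarith

/-- The total price of the descent of the running minimum is covered by the budgets
`0.99 P(u_n) / τ_n²`, `τ_n = n + u_n`. -/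
theorem sum_descent_le (ha : 1 / 2 ≤ a) (ha1 : a ≤ 1) {u : ℕ → ℝ} (hu1 : min (2 / π) a - 1 ≤ u 1)
    (hstep : ∀ n : ℕ, 1 ≤ n → u n - 1 / 3 ≤ u (n + 1)) (M : ℕ) :
    ∑ n ∈ Finset.range M, ∫ y in (runMin u (n + 1))..(runMin u n),
        humpPrim a y * tailWeight ((n + 1 : ℕ) + y) ≤
      0.99 * ∑ n ∈ Finset.range M, humpPrim a (u (n + 1)) / ((n + 1 : ℕ) + u (n + 1)) ^ 2 := by
  have hpos : 0 < a := by linarith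
  have hπ : 1 / 2 ≤ 2 / π := by
    rw [le_div_iff₀ pi_pos]; linarith [pi_le_four]
  have hmin : 1 / 2 ≤ min (2 / π) a := le_min hπ ha
  have hpos' : ∀ n : ℕ, 1 ≤ n → 1 / 2 + 2 / 3 * ((n : ℝ) - 1) ≤ n + u n := by
    intro n hn
    induction n, hn using Nat.le_induction with
    | base => push_cast; linarith
    | succ n hn ih => have := hstep n hn; push_cast; linarith
  rcases Nat.eq_zero_or_pos M with rfl | hM
  · simp
  suffices ∃ t z : ℝ, 0 < t ∧ t ≤ M + runMin u M ∧ -a ≤ z ∧ z < a ∧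
      (∀ s, humpPrim a (runMin u M + s) = bump a (z + s)) ∧
      (0 ≤ z → z ≤ 1 / 3 → z < (3 * a - 1) / 2 → 7 / 6 ≤ t) ∧
      ∑ n ∈ Finset.range M, (∫ y in (runMin u (n + 1))..(runMin u n),
        humpPrim a y * tailWeight ((n + 1 : ℕ) + y)) + credit a z t ≤
      0.99 * ∑ n ∈ Finset.range M, humpPrim a (u (n + 1)) / ((n + 1 : ℕ) + u (n + 1)) ^ 2 by
    obtain ⟨t, z, ht, -, -, hz, -, hg, h⟩ := this
    linarith [credit_nonneg ha ha1 ht hz hg]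
  induction M, hM using Nat.le_induction with
  | base =>
    set v := runMin u 1 with hv
    have hvdef : v = min 0 (u 1) := rfl
    have hv0 : v ≤ 0 := runMin_le_zero u 1
    have hvhalf : -(1 / 2) ≤ v := by rw [hvdef]; exact le_min (by norm_num) (by linarith)
    simp only [Finset.range_one, Finset.sum_singleton, zero_add, Nat.cast_one]
    rw [← hv, show runMin u 0 = 0 from rfl]
    have hbud : 0 ≤ 0.99 * (humpPrim a (u 1) / (1 + u 1) ^ 2) := by
      have := humpPrim_nonneg ha ha1 (u 1)
      positivity
    rcases le_or_gt (a - 1) v with hva | hva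
    · have e0 : ∫ y in v..0, humpPrim a y * tailWeight (1 + y) = 0 := by
        rw [integral_congr (g := fun _ => 0)]
        · simp
        · intro y hy
          rw [uIcc_of_le hv0] at hy
          simp only
          rw [humpPrim_eq_zero ha ha1 (by linarith [hy.1]) hy.2, zero_mul]
      obtain ⟨z, hz0, hz1, hzs, hzz⟩ : ∃ z, -a ≤ z ∧ z < a ∧
          (∀ s, humpPrim a (v + s) = bump a (z + s)) ∧ (z < 0 ∨ (3 * a - 1) / 2 ≤ z) := by
        rcases lt_or_ge (v + (a + 1) / 2) a with h | h
        · refine ⟨v + (a + 1) / 2, by linarith, h, fun s => ?_, Or.inr (by linarith)⟩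
          rw [humpPrim_eq_bump]; congr 1; ring
        · refine ⟨v + (a + 1) / 2 - 2 * a, by linarith, by linarith, fun s => ?_,
            Or.inl (by linarith)⟩
          rw [humpPrim_eq_bump, ← bump_sub_period hpos]; congr 1; ring
      refine ⟨1 + v, z, by linarith, by linarith, hz0, hz1, hzs, ?_, ?_⟩
      · intro h1 _ h3
        rcases hzz with h | h <;> linarith
      · have hbz : bump a z = 0 := by
          have := hzs 0
          rw [add_zero, add_zero, humpPrim_eq_zero ha ha1 hva hv0] at this
          exact this.symm
        have : credit a z (1 + v) = 0 := by
          unfold credit; simp [hbz]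
        rw [e0, this]
        linarith
    · have hvu : v = u 1 := by
        rw [hvdef]; apply min_eq_right
        by_contra hcon
        rw [hvdef, min_eq_left (by linarith)] at hva
        linarith
      have hap : 2 / π ≤ a := by
        by_contra hcon
        rw [min_eq_right (by linarith), ← hvu] at hu1
        linarith
      rw [min_eq_left hap, ← hvu] at hu1
      have hπ' : 0.63 < 2 / π := by
        rw [lt_div_iff₀ pi_pos]; linarith [pi_lt_d2]
      have hz13 : 1 / 3 < v + (a + 1) / 2 := by linarith
      refine ⟨1 + v, v + (a + 1) / 2, by linarith, le_rfl, by linarith, by linarith, fun s => ?_,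
        fun _ h _ => absurd h (not_le.2 hz13), ?_⟩
      · rw [humpPrim_eq_bump]; congr 1; ring
      · have : credit a (v + (a + 1) / 2) (1 + v) = 0 := by
          unfold credit
          rw [if_pos (by linarith), if_neg (not_le.2 hz13)]
        rw [this, add_zero, ← hvu]
        exact first_step_le ha ha1 hu1 hva
  | succ n hn ih =>
    obtain ⟨t, z, ht, htn, hz0, hz1, hzs, hgood, hsum⟩ := ih
    rw [Finset.sum_range_succ, Finset.sum_range_succ]
    rcases le_or_gt (runMin u n) (u (n + 1)) with h | h
    · have e : runMin u (n + 1) = runMin u n := min_eq_left h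
      refine ⟨t, z, ht, ?_, hz0, hz1, ?_, hgood, ?_⟩
      · rw [e]; push_cast; linarith
      · rw [e]; exact hzs
      · rw [e, integral_same]
        have : 0 ≤ humpPrim a (u (n + 1)) / ((n + 1 : ℕ) + u (n + 1)) ^ 2 :=
          div_nonneg (humpPrim_nonneg ha ha1 _) (sq_nonneg _)
        linarith
    · have e : runMin u (n + 1) = u (n + 1) := min_eq_right h.le
      rw [e]
      obtain ⟨g, hg⟩ : ∃ g, g = runMin u n - u (n + 1) := ⟨_, rfl⟩
      obtain ⟨t', ht'⟩ : ∃ t' : ℝ, t' = (n + 1 : ℕ) + u (n + 1) := ⟨_, rfl⟩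
      have hg0 : 0 < g := by linarith
      have hg3 : g ≤ 1 / 3 := by
        have := hstep n hn
        have := runMin_le u hn
        linarith
      have ht'7 : 7 / 6 ≤ t' := by
        have := hpos' (n + 1) (by omega)
        have h1 : (1 : ℝ) ≤ n := by exact_mod_cast hn
        rw [ht']; push_cast at *; linarith
      obtain ⟨w, hw0, hw1, hw⟩ : ∃ w, -a ≤ w ∧ w < a ∧ (w = z - g ∨ w = z - g + 2 * a) := by
        rcases le_or_gt (-a) (z - g) with h | h
        · exact ⟨z - g, h, by linarith, Or.inl rfl⟩
        · exact ⟨z - g + 2 * a, by linarith, by linarith, Or.inr rfl⟩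
      have hws : ∀ s, humpPrim a (u (n + 1) + s) = bump a (w + s) := by
        intro s
        rw [show u (n + 1) + s = runMin u n + (s - g) by rw [hg]; ring, hzs]
        rcases hw with h | h
        · rw [h]; congr 1; ring
        · rw [h, ← bump_add_period hpos]; congr 1; ring
      have hstep' := credit_step ha ha1 hz0 hz1 hw0 hw1 hg0 hg3 hw ht ht'7
        (by rw [ht', hg]; push_cast; linarith) hgood
      refine ⟨t', w, by linarith, ht'.le, hw0, hw1, hws, fun _ _ _ => ht'7, ?_⟩
      have eint : ∫ y in (u (n + 1))..(runMin u n), humpPrim a y * tailWeight ((n + 1 : ℕ) + y) =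
          ∫ x in t'..(t' + g), bump a (w + (x - t')) * tailWeight x := by
        have := integral_comp_add_left (a := u (n + 1)) (b := runMin u n)
          (fun x => bump a (w + (x - t')) * tailWeight x) ((n + 1 : ℕ) : ℝ)
        rw [← ht', show ((n + 1 : ℕ) : ℝ) + runMin u n = t' + g by rw [ht', hg]; ring] at this
        rw [← this]
        apply integral_congr
        intro y _
        simp only
        rw [← hws]
        congr 2
        rw [ht']; ring
      have eb : humpPrim a (u (n + 1)) = bump a w := by simpa using hws 0
      rw [eint, eb, ← ht', mul_add]
      rw [show 0.99 * (bump a w / t' ^ 2) = 0.99 * bump a w / t' ^ 2 by ring]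
      linarith

/-- The sum of all prices, in terms of the descent of the running minimum. -/
theorem sum_cost_le_descent (ha : 1 / 2 ≤ a) (ha1 : a ≤ 1) {u : ℕ → ℝ}
    (hu : ∀ n : ℕ, 1 ≤ n → 0 < n + u n) (M : ℕ) :
    ∑ n ∈ Finset.range M, (∫ y in (min (u (n + 1)) 0)..0,
        humpPrim a y * (2 / ((n + 1 : ℕ) + y) ^ 3)) +
      ∫ y in (runMin u M)..0, humpPrim a y * tailWeight ((M + 1 : ℕ) + y) ≤
    ∑ n ∈ Finset.range M, ∫ y in (runMin u (n + 1))..(runMin u n),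
        humpPrim a y * tailWeight ((n + 1 : ℕ) + y) := by
  induction M with
  | zero => simp [runMin]
  | succ M ih =>
    rw [Finset.sum_range_succ, Finset.sum_range_succ]
    have hm0 := runMin_le_zero u M
    have hm1 := runMin_le_zero u (M + 1)
    have hmm : runMin u (M + 1) ≤ runMin u M := min_le_left _ _
    have hmu : runMin u (M + 1) ≤ min (u (M + 1)) 0 := le_min (min_le_right _ _) hm1
    have hmp := add_runMin_pos hu (n := M + 1) (by omega)
    set N : ℝ := ((M + 1 : ℕ) : ℝ) with hN
    have hNN : ((M + 1 + 1 : ℕ) : ℝ) = N + 1 := by rw [hN]; push_cast; ring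
    have hN0 : 0 < N := by rw [hN]; positivity
    have h1 : ∫ y in (min (u (M + 1)) 0)..0, humpPrim a y * (2 / (N + y) ^ 3) ≤
        ∫ y in (runMin u (M + 1))..0, humpPrim a y * (2 / (N + y) ^ 3) := by
      apply integral_mono_interval hmu (min_le_right _ _) le_rfl
      · refine (ae_restrict_iff' measurableSet_Ioc).2 (Eventually.of_forall fun y hy => ?_)
        have : 0 < N + y := by linarith [hy.1]
        have := humpPrim_nonneg ha ha1 y
        simp only [Pi.zero_apply]
        positivity
      · exact intervalIntegrable_humpPrim_div hmp (by linarith)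
    have h2 : (∫ y in (runMin u (M + 1))..0, humpPrim a y * (2 / (N + y) ^ 3)) +
        ∫ y in (runMin u (M + 1))..0, humpPrim a y * tailWeight (N + 1 + y) ≤
        ∫ y in (runMin u (M + 1))..0, humpPrim a y * tailWeight (N + y) := by
      rw [← integral_add (intervalIntegrable_humpPrim_div hmp (by linarith))
        (intervalIntegrable_humpPrim_mul_tailWeight (by linarith) (by linarith))]
      apply integral_mono_on hm1
      · exact (intervalIntegrable_humpPrim_div hmp (by linarith)).add
          (intervalIntegrable_humpPrim_mul_tailWeight (by linarith) (by linarith))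
      · exact intervalIntegrable_humpPrim_mul_tailWeight hmp (by linarith)
      · intro y hy
        rw [← mul_add]
        apply mul_le_mul_of_nonneg_left _ (humpPrim_nonneg ha ha1 y)
        have := tailWeight_step (by linarith [hy.1] : 0 < N + y)
        rwa [show N + y + 1 = N + 1 + y by ring] at this
    have h3 := integral_add_adjacent_intervals
      (intervalIntegrable_humpPrim_mul_tailWeight (a := a) (N := N) (s := runMin u (M + 1))
        (t := runMin u M) hmp (by linarith))
      (intervalIntegrable_humpPrim_mul_tailWeight (a := a) (N := N) (s := runMin u M) (t := 0)
        (by linarith) (by linarith))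
    rw [hNN]
    linarith

/-- The sum of all prices is at most `0.99` times the sum of the budgets. -/
theorem sum_cost_le (ha : 1 / 2 ≤ a) (ha1 : a ≤ 1) {u : ℕ → ℝ} (hu1 : min (2 / π) a - 1 ≤ u 1)
    (hstep : ∀ n : ℕ, 1 ≤ n → u n - 1 / 3 ≤ u (n + 1)) (hu : ∀ n : ℕ, 1 ≤ n → 0 < n + u n)
    (M : ℕ) :
    ∑ n ∈ Finset.range M, (∫ y in (min (u (n + 1)) 0)..0,
        humpPrim a y * (2 / ((n + 1 : ℕ) + y) ^ 3)) ≤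
      0.99 * ∑ n ∈ Finset.range M, humpPrim a (u (n + 1)) / ((n + 1 : ℕ) + u (n + 1)) ^ 2 := by
  have h1 := sum_cost_le_descent ha ha1 hu M
  have h2 := sum_descent_le ha ha1 hu1 hstep M
  have h3 : 0 ≤ ∫ y in (runMin u M)..0, humpPrim a y * tailWeight ((M + 1 : ℕ) + y) := by
    apply integral_nonneg (runMin_le_zero u M)
    intro y hy
    apply mul_nonneg (humpPrim_nonneg ha ha1 y) (tailWeight_pos _).le
    rcases Nat.eq_zero_or_pos M with rfl | hM
    · simp only [runMin] at hy
      push_cast; linarith [hy.1]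
    · have := add_runMin_pos hu hM
      push_cast; linarith [hy.1]
  linarith
end

/-! ### The functional as a limit of sums over the breakpoints -/

/-- The squared positive part of the kernel on the `n`-th interval, with `a = 2/p`. -/
noncomputable def pieceIntegrand (a : ℝ) (n : ℕ) (x : ℝ) : ℝ :=
  sineHump a (x - n) / (π ^ 2 * x ^ 2)

theorem pieceIntegrand_nonneg (a : ℝ) (n : ℕ) (x : ℝ) : 0 ≤ pieceIntegrand a n x :=
  div_nonneg (sineHump_nonneg _ _) (by positivity)

theorem pieceIntegrand_le (a : ℝ) (n : ℕ) (x : ℝ) :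
    pieceIntegrand a n x ≤ 1 / (π ^ 2 * x ^ 2) :=
  div_le_div_of_nonneg_right (sineHump_le_one _ _) (by positivity)

theorem continuousOn_pieceIntegrand (a : ℝ) (n : ℕ) :
    ContinuousOn (pieceIntegrand a n) (Ioi 0) := by
  unfold pieceIntegrand
  apply ContinuousOn.div
  · exact ((continuous_sineHump a).comp (by fun_prop)).continuousOn
  · fun_prop
  · intro x hx
    have : (0 : ℝ) < x := hx
    positivity

theorem intervalIntegrable_pieceIntegrand (a : ℝ) (n : ℕ) {s t : ℝ} (hs : 0 < s) (ht : 0 < t) :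
    IntervalIntegrable (pieceIntegrand a n) volume s t :=
  ((continuousOn_pieceIntegrand a n).mono fun _ hx =>
    lt_of_lt_of_le (lt_min hs ht) hx.1).intervalIntegrable

/-- At the origin the zero of the sine cancels the pole of `1 / x²`. -/
theorem intervalIntegrable_pieceIntegrand_zero {a : ℝ} (ha : 0 < a) {t : ℝ} (ht : 0 ≤ t) :
    IntervalIntegrable (pieceIntegrand a 0) volume 0 t := by
  rw [intervalIntegrable_iff_integrableOn_Ioc_of_le ht]
  refine Measure.integrableOn_of_bounded (M := 1 / a ^ 2) (by simp) ?_ ?_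
  · apply Measurable.aestronglyMeasurable
    unfold pieceIntegrand
    exact ((continuous_sineHump a).measurable.comp (by fun_prop)).div (by fun_prop)
  · refine (ae_restrict_iff' measurableSet_Ioc).2 (Eventually.of_forall fun x hx => ?_)
    have hx0 : 0 < x := hx.1
    rw [norm_of_nonneg (pieceIntegrand_nonneg _ _ _)]
    unfold pieceIntegrand sineHump
    rw [div_le_div_iff₀ (by positivity) (by positivity)]
    have h1 : 0 ≤ max 0 (sin (π * (x - (0 : ℕ)) / a)) := le_max_left _ _
    have h2 : max 0 (sin (π * (x - (0 : ℕ)) / a)) ≤ π * x / a := by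
      apply max_le (by positivity)
      simp only [CharP.cast_eq_zero, sub_zero]
      exact sin_le (by positivity)
    calc _ ≤ (π * x / a) ^ 2 * a ^ 2 := by gcongr
      _ = _ := by field_simp

theorem integral_pieceIntegrand_le (a : ℝ) (n : ℕ) {s t : ℝ} (hs : 0 < s) (h : s ≤ t) :
    ∫ x in s..t, pieceIntegrand a n x ≤ (1 / s - 1 / t) / π ^ 2 := by
  have hmem : ∀ x ∈ uIcc s t, 0 < x := fun x hx => by
    rw [uIcc_of_le h] at hx; linarith [hx.1]
  have hint : IntervalIntegrable (fun x : ℝ => 1 / (π ^ 2 * x ^ 2)) volume s t := by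
    apply ContinuousOn.intervalIntegrable
    apply ContinuousOn.div (by fun_prop) (by fun_prop)
    intro x hx
    have := hmem x hx
    positivity
  have e : ∫ x in s..t, 1 / (π ^ 2 * x ^ 2) = (1 / s - 1 / t) / π ^ 2 := by
    rw [integral_eq_sub_of_hasDerivAt (f := fun x => -(x⁻¹ / π ^ 2)) (fun x hx => ?_) hint]
    · field_simp; ring
    · have hx0 := hmem x hx
      refine (((hasDerivAt_inv hx0.ne').div_const (π ^ 2)).neg).congr_deriv ?_
      field_simp
  rw [← e]
  exact integral_mono_on h (intervalIntegrable_pieceIntegrand a n hs (by linarith)) hint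
    fun x _ => pieceIntegrand_le a n x

theorem abs_integral_pieceIntegrand_le (a : ℝ) (n : ℕ) {s t : ℝ} (hs : 0 < s) (ht : 0 < t) :
    |∫ x in s..t, pieceIntegrand a n x| ≤ (1 / s + 1 / t) / π ^ 2 := by
  wlog h : s ≤ t generalizing s t
  · rw [integral_symm, abs_neg, add_comm]
    exact this ht hs (by linarith)
  rw [abs_of_nonneg (integral_nonneg h fun x _ => pieceIntegrand_nonneg a n x)]
  refine (integral_pieceIntegrand_le a n hs h).trans ?_
  have : 0 < 1 / t := by positivity
  gcongr
  linarith

theorem sq_max_kernelK {p : ℝ} (hp : 0 < p) {τ : ℕ → ℝ} (hτ : Monotone τ) {n : ℕ} {x : ℝ}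
    (hx : x ∈ Ioo (τ n) (τ (n + 1))) (hx0 : 0 < x) :
    (max 0 (kernelK p τ x)) ^ 2 = pieceIntegrand (2 / p) n x := by
  have e : kernelK p τ x = sin (p / 2 * π * (x - n)) / (π * x) := by
    unfold kernelK
    rw [tsum_eq_single n, indicator_of_mem hx]
    intro m hm
    apply indicator_of_notMem
    intro hxm
    rcases lt_or_gt_of_ne hm with h | h
    · have := hτ (show m + 1 ≤ n from h)
      linarith [hxm.2, hx.1]
    · have := hτ (show n + 1 ≤ m from h)
      linarith [hxm.1, hx.2]
  rw [e]
  unfold pieceIntegrand sineHump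
  rw [show π * (x - n) / (2 / p) = p / 2 * π * (x - n) by field_simp]
  have hd : max 0 (sin (p / 2 * π * (x - n)) / (π * x)) =
      max 0 (sin (p / 2 * π * (x - n))) / (π * x) := by
    have := max_div_div_right (by positivity : 0 ≤ π * x) 0 (sin (p / 2 * π * (x - n)))
    rwa [zero_div] at this
  rw [hd, div_pow, mul_pow]

section breakpoints
variable {p : ℝ} {τ : ℕ → ℝ}

theorem breakpoint_ge (h1 : 1 / 2 ≤ τ 1) (h2 : ∀ n : ℕ, 1 ≤ n → 2 / 3 ≤ τ (n + 1) - τ n) {n : ℕ}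
    (hn : 1 ≤ n) : 1 / 2 + 2 / 3 * ((n : ℝ) - 1) ≤ τ n := by
  induction n, hn using Nat.le_induction with
  | base => push_cast; linarith
  | succ n hn ih => have := h2 n hn; push_cast; linarith

theorem breakpoint_pos (h1 : 1 / 2 ≤ τ 1) (h2 : ∀ n : ℕ, 1 ≤ n → 2 / 3 ≤ τ (n + 1) - τ n) {n : ℕ}
    (hn : 1 ≤ n) : 0 < τ n := by
  have := breakpoint_ge h1 h2 hn
  have : (1 : ℝ) ≤ n := by exact_mod_cast hn
  linarith

theorem breakpoint_monotone (h0 : τ 0 = 0) (h1 : 1 / 2 ≤ τ 1)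
    (h2 : ∀ n : ℕ, 1 ≤ n → 2 / 3 ≤ τ (n + 1) - τ n) : Monotone τ := by
  apply monotone_nat_of_le_succ
  intro n
  rcases Nat.eq_zero_or_pos n with rfl | hn
  · rw [h0]; simp only [zero_add]; linarith
  · have := h2 n hn; linarith

theorem breakpoint_tendsto (h1 : 1 / 2 ≤ τ 1) (h2 : ∀ n : ℕ, 1 ≤ n → 2 / 3 ≤ τ (n + 1) - τ n) :
    Tendsto τ atTop atTop := by
  have h : Tendsto (fun n : ℕ => 1 / 2 + 2 / 3 * ((n : ℝ) - 1)) atTop atTop := by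
    apply tendsto_atTop_add_const_left
    apply Tendsto.const_mul_atTop (by norm_num)
    exact tendsto_atTop_add_const_right _ (-1) tendsto_natCast_atTop_atTop
  apply tendsto_atTop_mono' _ _ h
  filter_upwards [eventually_ge_atTop 1] with n hn
  exact breakpoint_ge h1 h2 hn

theorem intervalIntegrable_piece (hp : 0 < p) (h0 : τ 0 = 0) (h1 : 1 / 2 ≤ τ 1)
    (h2 : ∀ n : ℕ, 1 ≤ n → 2 / 3 ≤ τ (n + 1) - τ n) (n : ℕ) :
    IntervalIntegrable (pieceIntegrand (2 / p) n) volume (τ n) (τ (n + 1)) := by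
  rcases Nat.eq_zero_or_pos n with rfl | hn
  · rw [h0]
    exact intervalIntegrable_pieceIntegrand_zero (by positivity)
      (breakpoint_pos h1 h2 (by omega)).le
  · exact intervalIntegrable_pieceIntegrand _ _ (breakpoint_pos h1 h2 hn)
      (breakpoint_pos h1 h2 (by omega))

theorem kernel_ae_eq_piece (hp : 0 < p) (h0 : τ 0 = 0) (h1 : 1 / 2 ≤ τ 1)
    (h2 : ∀ n : ℕ, 1 ≤ n → 2 / 3 ≤ τ (n + 1) - τ n) (n : ℕ) :
    pieceIntegrand (2 / p) n =ᵐ[volume.restrict (uIoc (τ n) (τ (n + 1)))]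
      fun x => (max 0 (kernelK p τ x)) ^ 2 := by
  have hm := breakpoint_monotone h0 h1 h2
  rw [uIoc_of_le (hm (Nat.le_succ n)), ← restrict_Ioo_eq_restrict_Ioc]
  refine (ae_restrict_iff' measurableSet_Ioo).2 (Eventually.of_forall fun x hx => ?_)
  have hn : 0 ≤ τ n := h0 ▸ hm (Nat.zero_le n)
  exact (sq_max_kernelK hp hm hx (lt_of_le_of_lt hn hx.1)).symm

theorem intervalIntegrable_kernel (hp : 0 < p) (h0 : τ 0 = 0) (h1 : 1 / 2 ≤ τ 1)
    (h2 : ∀ n : ℕ, 1 ≤ n → 2 / 3 ≤ τ (n + 1) - τ n) (M : ℕ) :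
    IntervalIntegrable (fun x => (max 0 (kernelK p τ x)) ^ 2) volume 0 (τ M) := by
  have := IntervalIntegrable.trans_iterate (μ := volume) (a := τ) (n := M)
    (f := fun x => (max 0 (kernelK p τ x)) ^ 2) fun k _ =>
      (intervalIntegrable_piece hp h0 h1 h2 k).congr_ae (kernel_ae_eq_piece hp h0 h1 h2 k)
  rwa [h0] at this

theorem integral_kernel (hp : 0 < p) (h0 : τ 0 = 0) (h1 : 1 / 2 ≤ τ 1)
    (h2 : ∀ n : ℕ, 1 ≤ n → 2 / 3 ≤ τ (n + 1) - τ n) (M : ℕ) :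
    ∫ x in 0..(τ M), (max 0 (kernelK p τ x)) ^ 2 =
      ∑ n ∈ Finset.range M, ∫ x in (τ n)..(τ (n + 1)), pieceIntegrand (2 / p) n x := by
  have := sum_integral_adjacent_intervals (μ := volume) (a := τ) (n := M)
    (f := fun x => (max 0 (kernelK p τ x)) ^ 2) fun k _ =>
      (intervalIntegrable_piece hp h0 h1 h2 k).congr_ae (kernel_ae_eq_piece hp h0 h1 h2 k)
  rw [h0] at this
  rw [← this]
  refine Finset.sum_congr rfl fun n _ => ?_
  exact (integral_congr_ae_restrict (kernel_ae_eq_piece hp h0 h1 h2 n)).symm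

theorem integrableOn_kernel (hp : 0 < p) (h0 : τ 0 = 0) (h1 : 1 / 2 ≤ τ 1)
    (h2 : ∀ n : ℕ, 1 ≤ n → 2 / 3 ≤ τ (n + 1) - τ n) :
    IntegrableOn (fun x => (max 0 (kernelK p τ x)) ^ 2) (Ioi 0) := by
  have hm := breakpoint_monotone h0 h1 h2
  have hn0 : ∀ n, 0 ≤ τ n := fun n => h0 ▸ hm (Nat.zero_le n)
  have hbound : ∀ M : ℕ, ∑ n ∈ Finset.range (M + 1),
      ∫ x in (τ n)..(τ (n + 1)), pieceIntegrand (2 / p) n x ≤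
      (∫ x in (τ 0)..(τ 1), pieceIntegrand (2 / p) 0 x) + (1 / τ 1 - 1 / τ (M + 1)) / π ^ 2 := by
    intro M
    induction M with
    | zero => simp
    | succ M ih =>
      rw [Finset.sum_range_succ]
      have := integral_pieceIntegrand_le (2 / p) (M + 1) (breakpoint_pos h1 h2 (by omega))
        (hm (Nat.le_succ (M + 1)))
      have e : (1 / τ 1 - 1 / τ (M + 1 + 1)) / π ^ 2 = (1 / τ 1 - 1 / τ (M + 1)) / π ^ 2 +
        (1 / τ (M + 1) - 1 / τ (M + 1 + 1)) / π ^ 2 := by ring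
      rw [e]
      linarith
  refine integrableOn_Ioi_of_intervalIntegral_norm_bounded
    ((∫ x in (τ 0)..(τ 1), pieceIntegrand (2 / p) 0 x) + (1 / τ 1) / π ^ 2) 0
    (l := atTop) (b := fun M : ℕ => τ (M + 1)) (fun M => ?_)
    ((breakpoint_tendsto h1 h2).comp (tendsto_add_atTop_nat 1)) (Eventually.of_forall fun M => ?_)
  · rw [← intervalIntegrable_iff_integrableOn_Ioc_of_le (hn0 _)]
    exact intervalIntegrable_kernel hp h0 h1 h2 _
  · have e : ∀ x, ‖(max 0 (kernelK p τ x)) ^ 2‖ = (max 0 (kernelK p τ x)) ^ 2 :=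
      fun x => norm_of_nonneg (sq_nonneg _)
    simp only [e]
    rw [integral_kernel hp h0 h1 h2]
    refine (hbound M).trans ?_
    have : 0 < 1 / τ (M + 1) := one_div_pos.2 (breakpoint_pos h1 h2 (by omega))
    gcongr
    linarith

theorem tendsto_functionalE (hp : 0 < p) (h0 : τ 0 = 0) (h1 : 1 / 2 ≤ τ 1)
    (h2 : ∀ n : ℕ, 1 ≤ n → 2 / 3 ≤ τ (n + 1) - τ n) :
    Tendsto (fun M => ∑ n ∈ Finset.range M,
      ∫ x in (τ n)..(τ (n + 1)), pieceIntegrand (2 / p) n x) atTop (𝓝 (functionalE p τ)) := by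
  have := intervalIntegral_tendsto_integral_Ioi 0 (integrableOn_kernel hp h0 h1 h2)
    (breakpoint_tendsto h1 h2)
  refine this.congr fun M => ?_
  exact integral_kernel hp h0 h1 h2 M

/-- The loss caused by moving the breakpoint `n` to `t`. -/
noncomputable def breakpointLoss (a : ℝ) (n : ℕ) (t : ℝ) : ℝ :=
  (∫ x in (n + 1 : ℕ)..t, pieceIntegrand a (n + 1) x) -
    ∫ x in (n + 1 : ℕ)..t, pieceIntegrand a n x

/-- Summation by parts: the breakpoints contribute independently of each other. -/
theorem sum_piece_eq (a : ℝ) (h0 : τ 0 = 0) (h1 : 1 / 2 ≤ τ 1)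
    (h2 : ∀ n : ℕ, 1 ≤ n → 2 / 3 ≤ τ (n + 1) - τ n) (hp : 0 < a) (M : ℕ) :
    ∑ n ∈ Finset.range M, ∫ x in (τ n)..(τ (n + 1)), pieceIntegrand a n x =
      (∑ n ∈ Finset.range M, ∫ x in (n : ℝ)..(n + 1), pieceIntegrand a n x) -
      (∑ n ∈ Finset.range M, breakpointLoss a n (τ (n + 1))) +
      ∫ x in (M : ℝ)..(τ M), pieceIntegrand a M x := by
  induction M with
  | zero => simp [h0]
  | succ M ih =>
    have hM1 : (0 : ℝ) < (M : ℝ) + 1 := by positivity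
    have hτ1 : 0 < τ (M + 1) := breakpoint_pos h1 h2 (by omega)
    rw [Finset.sum_range_succ, Finset.sum_range_succ, Finset.sum_range_succ, ih]
    have key : (∫ x in (M : ℝ)..(τ M), pieceIntegrand a M x) +
        ∫ x in (τ M)..(τ (M + 1)), pieceIntegrand a M x =
        (∫ x in (M : ℝ)..(M + 1), pieceIntegrand a M x) +
        ∫ x in ((M : ℝ) + 1)..(τ (M + 1)), pieceIntegrand a M x := by
      rcases Nat.eq_zero_or_pos M with rfl | hM
      · have i1 : IntervalIntegrable (pieceIntegrand a 0) volume 0 (τ 1) :=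
          intervalIntegrable_pieceIntegrand_zero hp hτ1.le
        have i2 : IntervalIntegrable (pieceIntegrand a 0) volume 0 1 :=
          intervalIntegrable_pieceIntegrand_zero hp zero_le_one
        rw [h0]
        simp only [Nat.cast_zero, zero_add, integral_same]
        rw [integral_add_adjacent_intervals i2
          (intervalIntegrable_pieceIntegrand a 0 one_pos hτ1)]
      · have hM0 : (0 : ℝ) < M := by exact_mod_cast hM
        have hτ0 := breakpoint_pos h1 h2 hM
        rw [integral_add_adjacent_intervals (intervalIntegrable_pieceIntegrand a M hM0 hτ0)
            (intervalIntegrable_pieceIntegrand a M hτ0 hτ1),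
          integral_add_adjacent_intervals (intervalIntegrable_pieceIntegrand a M hM0 hM1)
            (intervalIntegrable_pieceIntegrand a M hM1 hτ1)]
    unfold breakpointLoss
    push_cast
    linarith

theorem tendsto_sum_breakpointLoss (hp : 0 < p) (h0 : τ 0 = 0) (h1 : 1 / 2 ≤ τ 1)
    (h2 : ∀ n : ℕ, 1 ≤ n → 2 / 3 ≤ τ (n + 1) - τ n) :
    Tendsto (fun M => ∑ n ∈ Finset.range M, breakpointLoss (2 / p) n (τ (n + 1))) atTop
      (𝓝 (functionalE p (fun n => n) - functionalE p τ)) := by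
  have e1 := tendsto_functionalE hp h0 h1 h2
  have e2 := tendsto_functionalE (τ := fun n => (n : ℝ)) hp (by simp) (by norm_num)
    (fun n _ => by push_cast; linarith)
  have e3 : Tendsto (fun M : ℕ => ∫ x in (M : ℝ)..(τ M), pieceIntegrand (2 / p) M x) atTop
      (𝓝 0) := by
    have b : Tendsto (fun M : ℕ => (1 / (M : ℝ) + 1 / τ M) / π ^ 2) atTop (𝓝 0) := by
      have b1 : Tendsto (fun M : ℕ => 1 / (M : ℝ)) atTop (𝓝 0) := tendsto_one_div_atTop_nhds_zero_nat
      have b2 : Tendsto (fun M : ℕ => 1 / τ M) atTop (𝓝 0) := by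
        simp only [one_div]
        exact (breakpoint_tendsto h1 h2).inv_tendsto_atTop
      simpa using (b1.add b2).div_const (π ^ 2)
    apply squeeze_zero_norm' _ b
    filter_upwards [eventually_ge_atTop 1] with M hM
    exact abs_integral_pieceIntegrand_le _ _ (by exact_mod_cast hM) (breakpoint_pos h1 h2 hM)
  have := (e2.sub e1).add e3
  rw [add_zero] at this
  refine this.congr fun M => ?_
  rw [sum_piece_eq (2 / p) h0 h1 h2 (by positivity)]
  push_cast
  ring

/-- Integration by parts in the loss of one breakpoint. -/
theorem breakpointLoss_eq (a : ℝ) (n : ℕ) {t : ℝ} (ht : 0 < t) :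
    π ^ 2 * breakpointLoss a n t =
      humpPrim a (t - (n + 1 : ℕ)) / t ^ 2 +
        ∫ y in 0..(t - (n + 1 : ℕ)), humpPrim a y * (2 / ((n + 1 : ℕ) + y) ^ 3) := by
  obtain ⟨N, hN⟩ : ∃ N : ℝ, N = (n + 1 : ℕ) := ⟨_, rfl⟩
  have hN0 : 0 < N := by rw [hN]; positivity
  unfold breakpointLoss
  rw [← hN, ← integral_sub (intervalIntegrable_pieceIntegrand a _ hN0 ht)
    (intervalIntegrable_pieceIntegrand a _ hN0 ht), ← intervalIntegral.integral_const_mul]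
  have hmem : ∀ x ∈ uIcc N t, 0 < x := fun x hx => lt_of_lt_of_le (lt_min hN0 ht) hx.1
  have hsub : ∫ y in 0..(t - N), humpPrim a y * (2 / (N + y) ^ 3) =
      ∫ x in N..t, humpPrim a (x - N) * (2 / x ^ 3) := by
    have := integral_comp_add_left (a := 0) (b := t - N)
      (fun x => humpPrim a (x - N) * (2 / x ^ 3)) N
    simp only [add_sub_cancel_left, add_zero, add_sub_cancel] at this
    exact this
  have hc1 : IntervalIntegrable (fun x => humpDiff a (x - N) / x ^ 2) volume N t := by
    apply ContinuousOn.intervalIntegrable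
    apply ContinuousOn.div
    · exact ((continuous_humpDiff a).comp (by fun_prop)).continuousOn
    · fun_prop
    · intro x hx; have := hmem x hx; positivity
  have hc2 : IntervalIntegrable (fun x => humpPrim a (x - N) * (2 / x ^ 3)) volume N t := by
    apply ContinuousOn.intervalIntegrable
    apply ContinuousOn.mul
    · exact ((continuous_humpPrim a).comp (by fun_prop)).continuousOn
    · apply ContinuousOn.div (by fun_prop) (by fun_prop)
      intro x hx; have := hmem x hx; positivity
  have hftc := integral_eq_sub_of_hasDerivAt (a := N) (b := t)
    (f := fun x => humpPrim a (x - N) / x ^ 2)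
    (f' := fun x => humpDiff a (x - N) / x ^ 2 - humpPrim a (x - N) * (2 / x ^ 3))
    (fun x hx => by
      have hx0 := hmem x hx
      have d1 := (hasDerivAt_humpPrim a (x - N)).comp_sub_const x N
      refine (d1.div (hasDerivAt_pow 2 x) (by positivity)).congr_deriv ?_
      field_simp
      push_cast
      ring) (hc1.sub hc2)
  rw [integral_sub hc1 hc2, sub_self, humpPrim_zero, zero_div, sub_zero] at hftc
  rw [hsub, ← hftc]
  have : ∫ x in N..t, π ^ 2 * (pieceIntegrand a (n + 1) x - pieceIntegrand a n x) =
      ∫ x in N..t, humpDiff a (x - N) / x ^ 2 := by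
    apply integral_congr
    intro x hx
    have hx0 := hmem x hx
    simp only [pieceIntegrand, humpDiff]
    rw [hN]
    push_cast
    rw [show x - ((n : ℝ) + 1) + 1 = x - n by ring]
    field_simp
  rw [this]
  ring
end breakpoints

/-! ### Optimality and the extremal sequences -/

section
variable {a p : ℝ}

theorem humpPrim_pos_of_hump (ha : 1 / 2 < a) (ha1 : a ≤ 1) {y : ℝ} (h0 : -(2 * a) < y)
    (h1 : y < a - 1) : 0 < humpPrim a y := by
  rw [humpPrim_eq_bump]
  exact bump_pos ha ha1 (abs_lt.2 ⟨by linarith, by linarith⟩)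

theorem humpPrim_pos_of_pos (ha : 1 / 2 < a) (ha1 : a ≤ 1) {y : ℝ} (h0 : 0 < y)
    (h1 : y < 3 * a - 1) : 0 < humpPrim a y := by
  rw [humpPrim_eq_bump, ← bump_sub_period (by linarith : 0 < a)]
  exact bump_pos ha ha1 (abs_lt.2 ⟨by linarith, by linarith⟩)

/-- The part of the loss of the breakpoint `n + u` that is left after the descent of the running
minimum has been paid for. -/
noncomputable def lossSurplus (a : ℝ) (n : ℕ) (u : ℝ) : ℝ :=
  0.01 * (humpPrim a u / (n + u) ^ 2) +
    ∫ y in 0..(max u 0), humpPrim a y * (2 / (n + y) ^ 3)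

theorem integral_humpPrim_div_nonneg (ha : 1 / 2 ≤ a) (ha1 : a ≤ 1) (n : ℕ) (u : ℝ) :
    0 ≤ ∫ y in 0..(max u 0), humpPrim a y * (2 / (n + y) ^ 3) := by
  apply integral_nonneg (le_max_right _ _)
  intro y hy
  have := humpPrim_nonneg ha ha1 y
  have := hy.1
  positivity

theorem lossSurplus_nonneg (ha : 1 / 2 ≤ a) (ha1 : a ≤ 1) (n : ℕ) (u : ℝ) :
    0 ≤ lossSurplus a n u := by
  have := humpPrim_nonneg ha ha1 u
  have := integral_humpPrim_div_nonneg ha ha1 n u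
  unfold lossSurplus
  positivity

theorem integral_split_sign (a : ℝ) (n : ℕ) (u : ℝ) :
    ∫ y in 0..u, humpPrim a y * (2 / (n + y) ^ 3) =
      (∫ y in 0..(max u 0), humpPrim a y * (2 / (n + y) ^ 3)) -
        ∫ y in (min u 0)..0, humpPrim a y * (2 / (n + y) ^ 3) := by
  rcases le_total u 0 with h | h
  · rw [max_eq_right h, min_eq_left h, integral_same, integral_symm]; ring
  · rw [max_eq_left h, min_eq_right h, integral_same]; ring

variable {τ : ℕ → ℝ}

theorem sum_lossSurplus_le (ha : 1 / 2 ≤ a) (ha1 : a ≤ 1) (hτ1 : min (2 / π) a ≤ τ 1)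
    (h2 : ∀ n : ℕ, 1 ≤ n → 2 / 3 ≤ τ (n + 1) - τ n) (M : ℕ) :
    ∑ n ∈ Finset.range M, lossSurplus a (n + 1) (τ (n + 1) - (n + 1 : ℕ)) ≤
      π ^ 2 * ∑ n ∈ Finset.range M, breakpointLoss a n (τ (n + 1)) := by
  have hπ : 1 / 2 ≤ 2 / π := by
    rw [le_div_iff₀ pi_pos]; linarith [pi_le_four]
  have h1 : 1 / 2 ≤ τ 1 := (le_min hπ ha).trans hτ1
  have hcost := sum_cost_le ha ha1 (u := fun n => τ n - n) (by push_cast; linarith)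
    (fun n hn => by have := h2 n hn; push_cast; linarith)
    (fun n hn => by have := breakpoint_pos h1 h2 hn; simpa using this) M
  simp only [add_sub_cancel] at hcost
  have e : ∀ n, π ^ 2 * breakpointLoss a n (τ (n + 1)) =
      lossSurplus a (n + 1) (τ (n + 1) - (n + 1 : ℕ)) +
      0.99 * (humpPrim a (τ (n + 1) - (n + 1 : ℕ)) / τ (n + 1) ^ 2) -
      ∫ y in (min (τ (n + 1) - (n + 1 : ℕ)) 0)..0,
        humpPrim a y * (2 / ((n + 1 : ℕ) + y) ^ 3) := by
    intro n
    rw [breakpointLoss_eq a n (breakpoint_pos h1 h2 (by omega)), integral_split_sign]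
    unfold lossSurplus
    rw [add_sub_cancel]
    ring
  rw [Finset.mul_sum, Finset.sum_congr rfl fun n _ => e n, Finset.sum_sub_distrib,
    Finset.sum_add_distrib, ← Finset.mul_sum]
  linarith

theorem sum_lossSurplus_le_functionalE (hp2 : 2 ≤ p) (hp4 : p ≤ 4) (h0 : τ 0 = 0)
    (hτ1 : min (2 / π) (2 / p) ≤ τ 1)
    (h2 : ∀ n : ℕ, 1 ≤ n → 2 / 3 ≤ τ (n + 1) - τ n) (M : ℕ) :
    ∑ n ∈ Finset.range M, lossSurplus (2 / p) (n + 1) (τ (n + 1) - (n + 1 : ℕ)) ≤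
      π ^ 2 * (functionalE p (fun n => n) - functionalE p τ) := by
  have hp : 0 < p := by linarith
  have ha : 1 / 2 ≤ 2 / p := by rw [le_div_iff₀ hp]; linarith
  have ha1 : 2 / p ≤ 1 := by rw [div_le_one hp]; linarith
  have hπ : 1 / 2 ≤ 2 / π := by
    rw [le_div_iff₀ pi_pos]; linarith [pi_le_four]
  have h1 : 1 / 2 ≤ τ 1 := (le_min hπ ha).trans hτ1
  have hlim := (tendsto_sum_breakpointLoss hp h0 h1 h2).const_mul (π ^ 2)
  apply ge_of_tendsto hlim
  filter_upwards [eventually_ge_atTop M] with M' hM'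
  refine le_trans ?_ (sum_lossSurplus_le ha ha1 hτ1 h2 M')
  exact Finset.sum_le_sum_of_subset_of_nonneg (Finset.range_mono hM')
    fun n _ _ => lossSurplus_nonneg ha ha1 _ _

theorem functionalE_le (hp2 : 2 ≤ p) (hp4 : p ≤ 4) (h0 : τ 0 = 0)
    (hτ1 : min (2 / π) (2 / p) ≤ τ 1)
    (h2 : ∀ n : ℕ, 1 ≤ n → 2 / 3 ≤ τ (n + 1) - τ n) :
    functionalE p τ ≤ functionalE p (fun n => n) := by
  have := sum_lossSurplus_le_functionalE hp2 hp4 h0 hτ1 h2 0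
  rw [Finset.sum_range_zero] at this
  have := nonneg_of_mul_nonneg_right this (by positivity)
  linarith

theorem mem_Icc_of_functionalE_eq (hp2 : 2 ≤ p) (hp4 : p < 4) (h0 : τ 0 = 0)
    (hτ1 : min (2 / π) (2 / p) ≤ τ 1)
    (h2 : ∀ n : ℕ, 1 ≤ n → 2 / 3 ≤ τ (n + 1) - τ n)
    (heq : functionalE p τ = functionalE p (fun n => n)) {n : ℕ} (hn : 1 ≤ n) :
    τ n ∈ Icc ((n : ℝ) - 1 + 2 / p) n := by
  have hp : 0 < p := by linarith
  have ha : 1 / 2 < 2 / p := by rw [lt_div_iff₀ hp]; linarith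
  have ha1 : 2 / p ≤ 1 := by rw [div_le_one hp]; linarith
  set a := 2 / p with hadef
  have hπ : 0.63 < 2 / π := by
    rw [lt_div_iff₀ pi_pos]; linarith [pi_lt_d2]
  have h1 : 1 / 2 ≤ τ 1 := (le_min (by linarith) ha.le).trans hτ1
  have hzero : ∀ k, 1 ≤ k → lossSurplus a k (τ k - k) = 0 := by
    intro k hk
    obtain ⟨j, rfl⟩ := Nat.exists_eq_add_of_le' hk
    have hs := sum_lossSurplus_le_functionalE hp2 hp4.le h0 hτ1 h2 (j + 1)
    rw [heq, sub_self, mul_zero] at hs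
    have hle := Finset.single_le_sum
      (f := fun n => lossSurplus a (n + 1) (τ (n + 1) - (n + 1 : ℕ)))
      (fun n _ => lossSurplus_nonneg ha.le ha1 _ _) (Finset.mem_range.2 (Nat.lt_succ_self j))
    exact le_antisymm (hle.trans hs) (lossSurplus_nonneg ha.le ha1 _ _)
  have hP : ∀ k, 1 ≤ k → humpPrim a (τ k - k) = 0 := by
    intro k hk
    have hz := hzero k hk
    unfold lossSurplus at hz
    have e1 := integral_humpPrim_div_nonneg ha.le ha1 k (τ k - k)
    have hpos := breakpoint_pos h1 h2 hk
    rw [add_sub_cancel] at hz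
    by_contra hne
    have : 0 < humpPrim a (τ k - k) :=
      lt_of_le_of_ne (humpPrim_nonneg ha.le ha1 _) (Ne.symm hne)
    have : 0 < humpPrim a (τ k - k) / τ k ^ 2 := by positivity
    linarith
  have hup : ∀ k, 1 ≤ k → τ k - k ≤ 0 := by
    intro k hk
    by_contra! hcon
    have hz := hzero k hk
    unfold lossSurplus at hz
    rw [hP k hk, zero_div, mul_zero, zero_add, max_eq_left hcon.le] at hz
    have hk0 : (0 : ℝ) < k := by exact_mod_cast hk
    obtain ⟨c, hc0, hc1, hc2⟩ : ∃ c, 0 < c ∧ c ≤ τ k - k ∧ c < 3 * a - 1 :=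
      ⟨min (τ k - k) ((3 * a - 1) / 2), lt_min hcon (by linarith), min_le_left _ _,
        (min_le_right _ _).trans_lt (by linarith)⟩
    have hint : ∀ s t : ℝ, 0 ≤ s → 0 ≤ t →
        IntervalIntegrable (fun y => humpPrim a y * (2 / ((k : ℝ) + y) ^ 3)) volume s t :=
      fun s t hs ht => intervalIntegrable_humpPrim_div (by linarith) (by linarith)
    have i1 : 0 < ∫ y in 0..c, humpPrim a y * (2 / ((k : ℝ) + y) ^ 3) := by
      apply intervalIntegral_pos_of_pos_on (hint _ _ le_rfl hc0.le) _ hc0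
      intro y hy
      have := humpPrim_pos_of_pos ha ha1 hy.1 (hy.2.trans hc2)
      have := hy.1
      positivity
    have i2 : 0 ≤ ∫ y in c..(τ k - k), humpPrim a y * (2 / ((k : ℝ) + y) ^ 3) := by
      apply integral_nonneg hc1
      intro y hy
      have := humpPrim_nonneg ha.le ha1 y
      have : 0 ≤ y := hc0.le.trans hy.1
      positivity
    have i3 := integral_add_adjacent_intervals (hint 0 c le_rfl hc0.le)
      (hint c (τ k - k) hc0.le hcon.le)
    linarith
  -- `P` vanishes at no point of the hump below `a - 1`, and the steps are too short to jump over it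
  have hlow : ∀ k, 1 ≤ k → a - 1 ≤ τ k - k := by
    intro k hk
    induction k, hk using Nat.le_induction with
    | base =>
      by_contra! hcon
      have h3 : (1 : ℝ) / 2 ≤ min (2 / π) a := le_min (by linarith) ha.le
      have := humpPrim_pos_of_hump ha ha1 (y := τ 1 - (1 : ℕ)) (by push_cast; linarith) hcon
      rw [hP 1 le_rfl] at this
      exact lt_irrefl _ this
    | succ k hk ih =>
      by_contra! hcon
      have h3 := h2 k hk
      have := humpPrim_pos_of_hump ha ha1 (y := τ (k + 1) - (k + 1 : ℕ))
        (by push_cast; linarith) hcon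
      rw [hP (k + 1) (by omega)] at this
      exact lt_irrefl _ this
  exact ⟨by linarith [hlow n hn], by linarith [hup n hn]⟩

theorem functionalE_eq_of_loss_eq_zero (hp : 0 < p) (h0 : τ 0 = 0) (h1 : 1 / 2 ≤ τ 1)
    (h2 : ∀ n : ℕ, 1 ≤ n → 2 / 3 ≤ τ (n + 1) - τ n)
    (h : ∀ n, breakpointLoss (2 / p) n (τ (n + 1)) = 0) :
    functionalE p τ = functionalE p (fun n => n) := by
  have := tendsto_sum_breakpointLoss hp h0 h1 h2
  simp only [h, Finset.sum_const_zero] at this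
  have := tendsto_nhds_unique this tendsto_const_nhds
  linarith

theorem breakpointLoss_eq_zero_of_mem (ha : 1 / 2 ≤ a) (ha1 : a ≤ 1) (n : ℕ) {t : ℝ} (ht : 0 < t)
    (hm : t ∈ Icc (((n + 1 : ℕ) : ℝ) - 1 + a) (n + 1 : ℕ)) : breakpointLoss a n t = 0 := by
  have h := breakpointLoss_eq a n ht
  have hl : a - 1 ≤ t - (n + 1 : ℕ) := by linarith [hm.1]
  have hr : t - (n + 1 : ℕ) ≤ 0 := by linarith [hm.2]
  rw [humpPrim_eq_zero ha ha1 hl hr, integral_congr (g := fun _ => 0)] at h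
  · simpa [pi_ne_zero] using h
  · intro y hy
    rw [uIcc_of_ge hr] at hy
    simp only
    rw [humpPrim_eq_zero ha ha1 (hl.trans hy.1) hy.2, zero_mul]

/-- For `p = 4` the hump has period one, so that moving breakpoints has no effect. -/
theorem breakpointLoss_half (n : ℕ) (t : ℝ) : breakpointLoss (1 / 2) n t = 0 := by
  unfold breakpointLoss
  rw [sub_eq_zero]
  apply integral_congr
  intro x _
  simp only [pieceIntegrand]
  rw [← sineHump_add_period (by norm_num) (x - (n + 1 : ℕ))]
  congr 2
  push_cast
  ring

theorem sin_sq_eq_pieceIntegrand (hp : 0 < p) (n : ℕ) {x : ℝ} (h0 : (n : ℝ) ≤ x)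
    (h1 : x ≤ n + 2 / p) :
    sin (p / 2 * π * (x - n)) ^ 2 / (π ^ 2 * x ^ 2) = pieceIntegrand (2 / p) n x := by
  unfold pieceIntegrand
  rw [sineHump_of_mem (by positivity) (by linarith) (by linarith),
    show π * (x - n) / (2 / p) = p / 2 * π * (x - n) by field_simp]

theorem intervalIntegrable_pieceIntegrand_nat (ha : 0 < a) (n : ℕ) {l : ℝ} (hl : 0 ≤ l) :
    IntervalIntegrable (pieceIntegrand a n) volume n (n + l) := by
  rcases Nat.eq_zero_or_pos n with rfl | hn
  · simpa using intervalIntegrable_pieceIntegrand_zero ha hl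
  · have : (0 : ℝ) < n := by exact_mod_cast hn
    exact intervalIntegrable_pieceIntegrand _ _ this (by linarith)

theorem integral_sin_sq_eq (hp2 : 2 ≤ p) (hp4 : p ≤ 4) (n : ℕ) :
    ∫ x in (n : ℝ)..(n + 2 / p), sin (p / 2 * π * (x - n)) ^ 2 / (π ^ 2 * x ^ 2) =
      ∫ x in (n : ℝ)..(n + 1), pieceIntegrand (2 / p) n x := by
  have hp : 0 < p := by linarith
  have ha : 1 / 2 ≤ 2 / p := by rw [le_div_iff₀ hp]; linarith
  have ha1 : 2 / p ≤ 1 := by rw [div_le_one hp]; linarith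
  have i1 := intervalIntegrable_pieceIntegrand_nat (by positivity : 0 < 2 / p) n
    (by positivity : 0 ≤ 2 / p)
  have i2 := intervalIntegrable_pieceIntegrand_nat (by positivity : 0 < 2 / p) n zero_le_one
  rw [← integral_add_adjacent_intervals i1 (i1.symm.trans i2)]
  have e : ∫ x in ((n : ℝ) + 2 / p)..(n + 1), pieceIntegrand (2 / p) n x = 0 := by
    rw [integral_congr (g := fun _ => 0)]
    · simp
    · intro x hx
      rw [uIcc_of_le (by linarith)] at hx
      simp only [pieceIntegrand]
      rw [sineHump_eq_zero (by positivity) (by linarith [hx.1]) (by linarith [hx.2]), zero_div]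
  rw [e, add_zero]
  apply integral_congr
  intro x hx
  rw [uIcc_of_le (by linarith)] at hx
  exact sin_sq_eq_pieceIntegrand hp n hx.1 hx.2
end

theorem theorem1p2 (p δ₁ δ₂ : ℝ) (hp : 2 ≤ p ∧ p ≤ 4)
    (hδ₁ : min (2 / Real.pi) (2 / p) ≤ δ₁ ∧ δ₁ ≤ 1)
    (hδ₂ : 2 / 3 ≤ δ₂ ∧ δ₂ ≤ 1) :
    -- all the integrals that occur converge
    (∀ τ ∈ separatedSeq δ₁ δ₂, MeasureTheory.IntegrableOn
      (fun x : ℝ => (max 0 (kernelK p τ x)) ^ 2) (Set.Ioi 0)) ∧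
    (∀ n : ℕ, IntervalIntegrable
      (fun x : ℝ => Real.sin (p / 2 * Real.pi * (x - n)) ^ 2 / (Real.pi ^ 2 * x ^ 2))
      MeasureTheory.volume n (n + 2 / p)) ∧
    -- `supE` is a genuine (finite) supremum, and it is the sum of the series
    IsLUB (functionalE p '' separatedSeq δ₁ δ₂) (supE p δ₁ δ₂) ∧
    HasSum (fun n : ℕ => ∫ x in (n : ℝ)..(n + 2 / p),
        Real.sin (p / 2 * Real.pi * (x - n)) ^ 2 / (Real.pi ^ 2 * x ^ 2))
      (supE p δ₁ δ₂) ∧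
    -- the sequences that attain it
    (p < 4 → ∀ τ ∈ separatedSeq δ₁ δ₂,
      (functionalE p τ = supE p δ₁ δ₂ ↔
        ∀ n : ℕ, 1 ≤ n → τ n ∈ Set.Icc ((n : ℝ) - 1 + 2 / p) n)) ∧
    (p = 4 → ∀ τ ∈ separatedSeq δ₁ δ₂, functionalE p τ = supE p δ₁ δ₂) := by
  obtain ⟨hp2, hp4⟩ := hp
  have hp0 : 0 < p := by linarith
  have ha : 1 / 2 ≤ 2 / p := by rw [le_div_iff₀ hp0]; linarith
  have ha1 : 2 / p ≤ 1 := by rw [div_le_one hp0]; linarith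
  have hπ : 1 / 2 ≤ 2 / π := by
    rw [le_div_iff₀ pi_pos]; linarith [pi_le_four]
  have hT : ∀ τ ∈ separatedSeq δ₁ δ₂, τ 0 = 0 ∧ min (2 / π) (2 / p) ≤ τ 1 ∧ 1 / 2 ≤ τ 1 ∧
      ∀ n : ℕ, 1 ≤ n → 2 / 3 ≤ τ (n + 1) - τ n := by
    rintro τ ⟨h0, h1, h2⟩
    exact ⟨h0, hδ₁.1.trans h1, ((le_min hπ ha).trans hδ₁.1).trans h1,
      fun n hn => hδ₂.1.trans (h2 n hn)⟩
  have hNT : (fun n : ℕ => (n : ℝ)) ∈ separatedSeq δ₁ δ₂ := by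
    refine ⟨by simp, by simpa using hδ₁.2, fun n _ => ?_⟩
    push_cast; linarith [hδ₂.2]
  have hgreatest : IsGreatest (functionalE p '' separatedSeq δ₁ δ₂)
      (functionalE p fun n => n) := by
    refine ⟨mem_image_of_mem _ hNT, ?_⟩
    rintro _ ⟨τ, hτ, rfl⟩
    obtain ⟨h0, hτ1, -, h2⟩ := hT τ hτ
    exact functionalE_le hp2 hp4 h0 hτ1 h2
  have hsup : supE p δ₁ δ₂ = functionalE p fun n => n := hgreatest.csSup_eq
  rw [hsup]
  refine ⟨fun τ hτ => ?_, fun n => ?_, hgreatest.isLUB, ?_, fun hlt τ hτ => ⟨fun h n hn => ?_,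
    fun h => ?_⟩, fun h4 τ hτ => ?_⟩
  · obtain ⟨h0, -, h1, h2⟩ := hT τ hτ
    exact integrableOn_kernel hp0 h0 h1 h2
  · refine (intervalIntegrable_pieceIntegrand_nat (by positivity : 0 < 2 / p) n
      (by positivity : 0 ≤ 2 / p)).congr fun x hx => ?_
    rw [uIoc_of_le (by linarith)] at hx
    exact (sin_sq_eq_pieceIntegrand hp0 n hx.1.le hx.2).symm
  · simp only [integral_sin_sq_eq hp2 hp4]
    rw [hasSum_iff_tendsto_nat_of_nonneg fun n => integral_nonneg (by linarith)
      fun x _ => pieceIntegrand_nonneg _ _ _]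
    obtain ⟨h0, -, h1, h2⟩ := hT _ hNT
    simpa using tendsto_functionalE hp0 h0 h1 h2
  · obtain ⟨h0, hτ1, -, h2⟩ := hT τ hτ
    exact mem_Icc_of_functionalE_eq hp2 hlt h0 hτ1 h2 h hn
  · obtain ⟨h0, -, h1, h2⟩ := hT τ hτ
    exact functionalE_eq_of_loss_eq_zero hp0 h0 h1 h2 fun n =>
      breakpointLoss_eq_zero_of_mem ha ha1 n (breakpoint_pos h1 h2 (by omega)) (h (n + 1) (by omega))
  · obtain ⟨h0, -, h1, h2⟩ := hT τ hτ
    refine functionalE_eq_of_loss_eq_zero hp0 h0 h1 h2 fun n => ?_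
    rw [h4, show (2 : ℝ) / 4 = 1 / 2 by norm_num]
    exact breakpointLoss_half n _
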